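/- Let $k\ge 1$ and $r\ge 2$ be integers such that $k+1$ and $r-1$ are relatively prime, and let $t,q\in\mathbb{C}$ be primitive roots of unity of orders $k+1$ and $r-1$, respectively. For a finite set $S\subset\mathbb{C}\setminus\{0\}$, a symmetric polynomial $f\in\mathbb{C}[x_1,\dots,x_n]^{\mathfrak{S}_n}$ satisfies the wheel condition relative to $S$ if, for every $1\le l\le n$ and all $t_1,\dots,t_l\in S$ with $t_1t_2\cdots t_l=1$, it vanishes at all points with $$x_2=t_1x_1,\quad x_3=t_2x_2,\quad\dots,\quad x_l=t_{l-1}x_{l-1},\quad x_1=t_lx_l .$$ Let $F^{(k,r)}_n$ be the space of symmetric polynomials in $n$ variables satisfying the wheel condition relative to $S=\{t,tq,\dots,tq^{r-2}\}$ (so $S=\{t\}$ when $r=2$), and let $F^{(k,r)}_{n,m}$ be its subspace of homogeneous polynomials of degree $m$, which is finite dimensional. Let $$\chi_{k,r}(z,v)=\sum_{n,m\ge 0}\dim\bigl(F^{(k,r)}_{n,m}\bigr)\,z^nv^m$$ be the character of $F^{(k,r)}=\bigoplus_n F^{(k,r)}_n$. Define formal power series in $v$ by $$b_n^{(k)}(v)=\sum_{\substack{a,b\ge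 0\\ (k+1)a+b=n}}\frac{(-1)^a\,v^{(k+1)a(a-1)/2}}{\prod_{i=1}^a(1-v^{(k+1)i})\,\prod_{j=1}^b(1-v^j)} .$$ Then $\chi_{k,2}(z,v)=\sum_{n\ge 0}b_n^{(k)}(v)\,z^n$, and $$\chi_{k,r}(z,v)=\sum_{n=0}^\infty\left(b_n^{(k)}(v^{r-1})\prod_{s=1}^n\frac{1-v^{s(r-1)}}{1-v^s}\right)z^n .$$ -/

import Mathlib

namespace WheelCondition

/-- A polynomial `f` in `n` variables satisfies the wheel condition relative to `S` if it vanishes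
at every point `x` whose first `l` coordinates form a wheel
`x₂ = τ₁ x₁, x₃ = τ₂ x₂, …, x_l = τ_{l-1} x_{l-1}, x₁ = τ_l x_l`
with `τ₁, …, τ_l ∈ S` and `τ₁ ⋯ τ_l = 1` (resonance), for every number `1 ≤ l ≤ n`.
Here `finRotate l` is the cyclic shift `i ↦ i + 1` of the indices of the wheel. -/
def Satisfies (S : Set ℂ) {n : ℕ} (f : MvPolynomial (Fin n) ℂ) : Prop :=
  ∀ l : ℕ, 0 < l → ∀ hl : l ≤ n, ∀ τ : Fin l → ℂ, (∀ i, τ i ∈ S) → ∏ i, τ i = 1 →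
    ∀ x : Fin n → ℂ,
      (∀ i : Fin l, x (Fin.castLE hl (finRotate l i)) = τ i * x (Fin.castLE hl i)) →
        MvPolynomial.eval x f = 0

/-- The wheel set `{t, t q, …, t q ^ (m - 1)}`. -/
def wheelSet (m : ℕ) (q t : ℂ) : Set ℂ := {a | ∃ s < m, a = t * q ^ s}

/-- The space of symmetric polynomials in `n` variables satisfying the wheel condition
relative to `S`. -/
noncomputable def symSpace (S : Set ℂ) (n : ℕ) : Submodule ℂ (MvPolynomial (Fin n) ℂ) where
  carrier := {f | f.IsSymmetric ∧ Satisfies S f}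
  zero_mem' := ⟨MvPolynomial.IsSymmetric.zero, fun _ _ _ _ _ _ _ _ => map_zero _⟩
  add_mem' := fun hf hg => ⟨hf.1.add hg.1, fun l h0 hl τ hτ hp x hx => by
    rw [map_add, hf.2 l h0 hl τ hτ hp x hx, hg.2 l h0 hl τ hτ hp x hx, add_zero]⟩
  smul_mem' := fun c _ hf => ⟨hf.1.smul c, fun l h0 hl τ hτ hp x hx => by
    rw [MvPolynomial.smul_eval, hf.2 l h0 hl τ hτ hp x hx, mul_zero]⟩

/-- The polynomials of `symSpace S n` that are homogeneous of degree `m`. -/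
noncomputable def gradedPiece (S : Set ℂ) (n m : ℕ) : Submodule ℂ (MvPolynomial (Fin n) ℂ) :=
  symSpace S n ⊓ MvPolynomial.homogeneousSubmodule (Fin n) ℂ m

instance (S : Set ℂ) (n m : ℕ) : FiniteDimensional ℂ (gradedPiece S n m) :=
  haveI : FiniteDimensional ℂ (MvPolynomial.homogeneousSubmodule (Fin n) ℂ m) :=
    Module.Finite.iff_fg.mpr (MvPolynomial.homogeneousSubmodule_fg (Fin n) ℂ m)
  Submodule.finiteDimensional_of_le inf_le_right

/-- The character `∑ g_{n,m} z ^ n v ^ m`, where `g_{n,m}` is the dimension of the degree `m` part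
of the space of `n`-variable symmetric polynomials satisfying the wheel condition relative to `S`.
It is a power series in `z` whose coefficients are power series in `v`. -/
noncomputable def character (S : Set ℂ) : PowerSeries (PowerSeries ℚ) :=
  PowerSeries.mk fun n => PowerSeries.mk fun m => (Module.finrank ℂ (gradedPiece S n m) : ℚ)

open PowerSeries in
/-- The power series in `v = X`
`b_n^{(k)}(v) = ∑_{(k+1)a+b=n} (-1)^a v^{(k+1)a(a-1)/2} / (∏_{i=1}^a (1-v^{(k+1)i}) ∏_{j=1}^b (1-v^j))`;
the sum is over all pairs `(a, b)` of nonnegative integers (necessarily at most `n`). -/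
noncomputable def bCoeff (k n : ℕ) : PowerSeries ℚ :=
  ∑ p ∈ (Finset.range (n + 1) ×ˢ Finset.range (n + 1)).filter
      (fun p : ℕ × ℕ => (k + 1) * p.1 + p.2 = n),
    (-1) ^ p.1 * X ^ ((k + 1) * p.1 * (p.1 - 1) / 2) *
      ((∏ i ∈ Finset.Icc 1 p.1, (1 - X ^ ((k + 1) * i))) *
        ∏ j ∈ Finset.Icc 1 p.2, (1 - X ^ j))⁻¹

end WheelCondition

namespace WheelCondition

section LeadingTerm

open MvPolynomial
open scoped Pointwise

variable {ι D : Type*} [AddCommMonoid D] (δ : (ι →₀ ℕ) →+ D) (Q : (ι →₀ ℕ) →+ ℕ)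

/-- `p` is the sum of the term `a x ^ γ` and of terms with exponents of the same degree `δ` as `γ`
and of larger order `Q`. -/
def HasLeadingTerm (p : MvPolynomial ι ℂ) (a : ℂ) (γ : ι →₀ ℕ) : Prop :=
  p - monomial γ a ∈ restrictSupport ℂ {m | δ m = δ γ ∧ Q γ < Q m}

variable {δ Q} {p p' : MvPolynomial ι ℂ} {a a' : ℂ} {γ γ' : ι →₀ ℕ}

theorem HasLeadingTerm.monomial (γ : ι →₀ ℕ) (a : ℂ) :
    HasLeadingTerm δ Q (monomial γ a) a γ := by
  simp [HasLeadingTerm]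

theorem HasLeadingTerm.mul (h : HasLeadingTerm δ Q p a γ) (h' : HasLeadingTerm δ Q p' a' γ') :
    HasLeadingTerm δ Q (p * p') (a * a') (γ + γ') := by
  have key : ∀ {s t : Set (ι →₀ ℕ)} {u w : MvPolynomial ι ℂ}, u ∈ restrictSupport ℂ s →
      w ∈ restrictSupport ℂ t → s + t ⊆ {m | δ m = δ (γ + γ') ∧ Q (γ + γ') < Q m} →
      u * w ∈ restrictSupport ℂ {m | δ m = δ (γ + γ') ∧ Q (γ + γ') < Q m} := by
    intro s t u w hu hw hst
    refine restrictSupport_mono ℂ hst ?_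
    rw [restrictSupport_add]
    exact Submodule.mul_mem_mul hu hw
  have hγ : MvPolynomial.monomial γ a ∈ restrictSupport ℂ {γ} := by simp
  have hγ' : MvPolynomial.monomial γ' a' ∈ restrictSupport ℂ {γ'} := by simp
  have e : p * p' - MvPolynomial.monomial (γ + γ') (a * a') =
      (p - MvPolynomial.monomial γ a) * (p' - MvPolynomial.monomial γ' a') +
      MvPolynomial.monomial γ a * (p' - MvPolynomial.monomial γ' a') +
      (p - MvPolynomial.monomial γ a) * MvPolynomial.monomial γ' a' := by
    have : MvPolynomial.monomial (γ + γ') (a * a') =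
      MvPolynomial.monomial γ a * MvPolynomial.monomial γ' a' := by
      rw [MvPolynomial.monomial_mul]
    rw [this]; ring
  unfold HasLeadingTerm
  rw [e]
  refine add_mem (add_mem (key h h' ?_) (key hγ h' ?_)) (key h hγ' ?_)
  · rintro _ ⟨m, ⟨h1, h2⟩, m', ⟨h3, h4⟩, rfl⟩
    exact ⟨by simp [h1, h3], by simp only [map_add]; omega⟩
  · rintro _ ⟨m, rfl, m', ⟨h3, h4⟩, rfl⟩
    exact ⟨by simp [h3], by simp only [map_add]; omega⟩
  · rintro _ ⟨m, ⟨h1, h2⟩, m', rfl, rfl⟩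
    exact ⟨by simp [h1], by simp only [map_add]; omega⟩

theorem HasLeadingTerm.one : HasLeadingTerm δ Q 1 1 0 := by
  simpa using HasLeadingTerm.monomial (δ := δ) (Q := Q) 0 1

theorem HasLeadingTerm.pow (h : HasLeadingTerm δ Q p a γ) (j : ℕ) :
    HasLeadingTerm δ Q (p ^ j) (a ^ j) (j • γ) := by
  induction j with
  | zero => simpa using HasLeadingTerm.one
  | succ j ih => rw [pow_succ, pow_succ, succ_nsmul]; exact ih.mul h

theorem HasLeadingTerm.prod {κ : Type*} (s : Finset κ) {p : κ → MvPolynomial ι ℂ} {a : κ → ℂ}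
    {γ : κ → ι →₀ ℕ} (h : ∀ i ∈ s, HasLeadingTerm δ Q (p i) (a i) (γ i)) :
    HasLeadingTerm δ Q (∏ i ∈ s, p i) (∏ i ∈ s, a i) (∑ i ∈ s, γ i) := by
  classical
  induction s using Finset.induction_on with
  | empty => simpa using HasLeadingTerm.one
  | insert i s hi ih =>
    rw [Finset.prod_insert hi, Finset.prod_insert hi, Finset.sum_insert hi]
    exact (h i (by simp)).mul (ih fun j hj => h j (by simp [hj]))

theorem HasLeadingTerm.mem_restrictSupport (h : HasLeadingTerm δ Q p a γ) :
    p ∈ restrictSupport ℂ {m | δ m = δ γ} := by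
  rw [← sub_add_cancel p (MvPolynomial.monomial γ a)]
  exact add_mem (restrictSupport_mono ℂ (fun m hm => hm.1) h) (by simp)

theorem HasLeadingTerm.coeff_self (h : HasLeadingTerm δ Q p a γ) : coeff γ p = a := by
  classical
  have : coeff γ (p - MvPolynomial.monomial γ a) = 0 := by
    by_contra hc
    exact lt_irrefl _ (h (mem_support_iff.2 hc)).2
  simpa [coeff_monomial, sub_eq_zero] using this

theorem HasLeadingTerm.lt_of_coeff_ne_zero (h : HasLeadingTerm δ Q p a γ) {m : ι →₀ ℕ}
    (hm : coeff m p ≠ 0) (hne : m ≠ γ) : Q γ < Q m := by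
  classical
  have : coeff m (p - MvPolynomial.monomial γ a) ≠ 0 := by
    simpa [coeff_monomial, hne.symm] using hm
  exact (h (mem_support_iff.2 this)).2

/-- A family with nonzero leading terms spans every graded piece. -/
theorem monomial_mem_span_of_hasLeadingTerm {v : (ι →₀ ℕ) → MvPolynomial ι ℂ}
    {c : (ι →₀ ℕ) → ℂ} (hc : ∀ γ, c γ ≠ 0) (hv : ∀ γ, HasLeadingTerm δ Q (v γ) (c γ) γ)
    {B : D → ℕ} (hB : ∀ γ, Q γ ≤ B (δ γ)) (γ : ι →₀ ℕ) :
    MvPolynomial.monomial γ (1 : ℂ) ∈ Submodule.span ℂ (v '' {m | δ m = δ γ}) := by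
  induction hN : B (δ γ) - Q γ using Nat.strong_induction_on generalizing γ with
  | _ N ih =>
  have h1 : v γ - MvPolynomial.monomial γ (c γ) ∈ Submodule.span ℂ (v '' {m | δ m = δ γ}) := by
    have h2 := hv γ
    unfold HasLeadingTerm at h2
    rw [restrictSupport_eq_span] at h2
    refine Submodule.span_le.2 ?_ h2
    rintro _ ⟨m, ⟨hm1, hm2⟩, rfl⟩
    have := ih (B (δ m) - Q m) (by have := hB m; rw [hm1] at this ⊢; omega) m rfl
    rwa [hm1] at this
  have h2 : v γ ∈ Submodule.span ℂ (v '' {m | δ m = δ γ}) :=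
    Submodule.subset_span ⟨γ, rfl, rfl⟩
  have h3 := Submodule.smul_mem _ (c γ)⁻¹ (sub_mem h2 h1)
  simpa [smul_monomial, hc γ] using h3

/-- A family with nonzero leading terms is linearly independent. -/
theorem linearIndependent_of_hasLeadingTerm {v : (ι →₀ ℕ) → MvPolynomial ι ℂ}
    {c : (ι →₀ ℕ) → ℂ} (hc : ∀ γ, c γ ≠ 0) (hv : ∀ γ, HasLeadingTerm δ Q (v γ) (c γ) γ) :
    LinearIndependent ℂ v := by
  rw [linearIndependent_iff]
  intro l hl
  by_contra hne
  obtain ⟨γ, hγ, hmin⟩ := l.support.exists_min_image Q (Finsupp.support_nonempty_iff.2 hne)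
  have h := congrArg (coeff γ) hl
  rw [Finsupp.linearCombination_apply, Finsupp.sum, coeff_sum, Finset.sum_eq_single γ] at h
  · rw [coeff_smul, (hv γ).coeff_self, coeff_zero, smul_eq_mul] at h
    exact mul_ne_zero (Finsupp.mem_support_iff.1 hγ) (hc γ) h
  · intro m hm hmγ
    by_contra hcoef
    have : coeff γ (v m) ≠ 0 := fun h0 => hcoef (by simp [h0])
    have := (hv m).lt_of_coeff_ne_zero this hmγ.symm
    have := hmin m hm
    omega
  · intro h0; exact absurd hγ h0

variable [Fintype ι]

/-- The products `∏ xᵢ ^ (γᵢ % K) Pᵢ ^ (γᵢ / K)`. -/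
noncomputable def adapted (K : ℕ) (P : ι → MvPolynomial ι ℂ) (γ : ι →₀ ℕ) : MvPolynomial ι ℂ :=
  ∏ i, (X i ^ (γ i % K) * P i ^ (γ i / K))

theorem mul_adapted {K : ℕ} (hK : 0 < K) (P : ι → MvPolynomial ι ℂ) (i : ι) (γ : ι →₀ ℕ) :
    P i * adapted K P γ = adapted K P (γ + Finsupp.single i K) := by
  classical
  have : P i = ∏ j, (if j = i then P j else 1) := by simp
  conv_lhs => rw [this]
  rw [adapted, adapted, ← Finset.prod_mul_distrib]
  refine Finset.prod_congr rfl fun j _ => ?_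
  by_cases h : j = i
  · subst h
    simp only [if_true, Finsupp.add_apply, Finsupp.single_eq_same, Nat.add_mod_right,
      Nat.add_div_right _ hK, pow_succ]
    ring
  · simp [h]

theorem HasLeadingTerm.adapted {K : ℕ} {P : ι → MvPolynomial ι ℂ}
    {c : ι → ℂ} (h : ∀ i, HasLeadingTerm δ Q (P i) (c i) (Finsupp.single i K)) (γ : ι →₀ ℕ) :
    HasLeadingTerm δ Q (adapted K P γ) (∏ i, c i ^ (γ i / K)) γ := by
  have h1 := HasLeadingTerm.prod (δ := δ) (Q := Q) Finset.univ
    (p := fun i => X i ^ (γ i % K) * P i ^ (γ i / K))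
    (a := fun i => c i ^ (γ i / K)) (γ := fun i => Finsupp.single i (γ i)) (fun i _ => by
      have h2 := (HasLeadingTerm.monomial (δ := δ) (Q := Q) (Finsupp.single i 1) 1).pow (γ i % K)
      have h3 := h2.mul ((h i).pow (γ i / K))
      have e : (γ i % K) • Finsupp.single i 1 + (γ i / K) • Finsupp.single i K =
          Finsupp.single i (γ i) := by
        rw [Finsupp.smul_single, Finsupp.smul_single, ← Finsupp.single_add]
        simp [mul_comm, Nat.mod_add_div]
      rw [e] at h3
      simpa [X] using h3)
  have e : ∑ i, Finsupp.single i (γ i) = γ := Finsupp.univ_sum_single γ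
  rw [e] at h1
  exact h1

end LeadingTerm

section NormPoly

open Polynomial

variable {R : Type*} [CommRing R] [Algebra ℂ R] {d : ℕ}

/-- The generating polynomial `∑ xₘ z ^ m`. -/
noncomputable def genPoly (x : Fin (d + 1) → R) : R[X] := ∑ m, C (x m) * X ^ (m : ℕ)

/-- The product of the `genPoly x` at `z, ζ z, …, ζ ^ (K - 1) z`. -/
noncomputable def normPoly (K : ℕ) (ζ : ℂ) (x : Fin (d + 1) → R) : R[X] :=
  ∏ i : Fin K, (genPoly x).comp (C (algebraMap ℂ R (ζ ^ (i : ℕ))) * X)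

theorem coeff_normPoly (K : ℕ) (ζ : ℂ) (x : Fin (d + 1) → R) (j : ℕ) :
    (normPoly K ζ x).coeff j = ∑ a : Fin K → Fin (d + 1), if ∑ i, (a i : ℕ) = j then
      ζ ^ (∑ i : Fin K, (i : ℕ) * (a i : ℕ)) • ∏ i, x (a i) else 0 := by
  have h1 : ∀ i : Fin K, (genPoly x).comp (C (algebraMap ℂ R (ζ ^ (i : ℕ))) * X) =
      ∑ m : Fin (d + 1), C (ζ ^ ((i : ℕ) * (m : ℕ)) • x m) * X ^ (m : ℕ) := by
    intro i
    rw [genPoly, Polynomial.sum_comp]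
    refine Finset.sum_congr rfl fun m _ => ?_
    rw [mul_comp, C_comp, pow_comp, X_comp, mul_pow, ← C_pow, ← mul_assoc, ← C_mul,
      Algebra.smul_def, ← map_pow, ← pow_mul, mul_comm (x m)]
  rw [normPoly, Finset.prod_congr rfl (fun i _ => h1 i), Finset.prod_univ_sum, finsetSum_coeff,
    Fintype.piFinset_univ]
  refine Finset.sum_congr rfl fun a _ => ?_
  rw [Finset.prod_mul_distrib, Finset.prod_pow_eq_pow_sum, ← map_prod, coeff_C_mul, coeff_X_pow,
    Finset.prod_smul, Finset.prod_pow_eq_pow_sum]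
  simp only [mul_ite, mul_one, mul_zero, eq_comm]

theorem coeff_normPoly_of_lt {K : ℕ} (ζ : ℂ) (x : Fin (d + 1) → R) {j : ℕ} (hj : K * d < j) :
    (normPoly K ζ x).coeff j = 0 := by
  rw [coeff_normPoly]
  refine Finset.sum_eq_zero fun a _ => if_neg ?_
  have : ∑ i, (a i : ℕ) ≤ ∑ _i : Fin K, d := Finset.sum_le_sum fun i _ => by have := (a i).2; omega
  simp at this
  omega

theorem coeff_normPoly_of_not_dvd {K : ℕ} (hK : 0 < K) {ζ : ℂ} (hζ : IsPrimitiveRoot ζ K)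
    (x : Fin (d + 1) → R) {j : ℕ} (hj : ¬ K ∣ j) : (normPoly K ζ x).coeff j = 0 := by
  obtain ⟨K, rfl⟩ : ∃ k, K = k + 1 := ⟨K - 1, by omega⟩
  have h : (normPoly (K + 1) ζ x).comp (C (algebraMap ℂ R ζ) * X) = normPoly (K + 1) ζ x := by
    rw [normPoly, Polynomial.prod_comp, Fin.prod_univ_castSucc, Fin.prod_univ_succ, mul_comm]
    congr 1
    · have : (C (algebraMap ℂ R ζ) : R[X]) ^ (K + 1) = 1 := by
        rw [← map_pow, ← map_pow, hζ.pow_eq_one, map_one, map_one]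
      simp [comp_assoc, ← mul_assoc, ← pow_succ, this]
    · refine Finset.prod_congr rfl fun i _ => ?_
      simp [comp_assoc, ← mul_assoc, ← pow_succ]
  have h1 := congrArg (fun p => p.coeff j) h
  simp only [comp_C_mul_X_coeff] at h1
  have h2 : (ζ ^ j - 1) • (normPoly (K + 1) ζ x).coeff j = 0 := by
    rw [sub_smul, one_smul, sub_eq_zero, Algebra.smul_def, map_pow, mul_comm, h1]
  refine (smul_eq_zero.1 h2).resolve_left ?_
  rw [sub_eq_zero, hζ.pow_eq_one_iff_dvd]
  exact hj

end NormPoly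

open MvPolynomial in
theorem hasLeadingTerm_coeff_normPoly {ι D : Type*} [AddCommMonoid D] {δ : (ι →₀ ℕ) →+ D}
    {Q : (ι →₀ ℕ) →+ ℕ} {d : ℕ} (μ : Fin (d + 1) → ι →₀ ℕ) {A B : D}
    (hδ : ∀ m, δ (μ m) = A + (m : ℕ) • B) (hQ : ∀ m, Q (μ m) = (m : ℕ) ^ 2) (K : ℕ) (ζ : ℂ)
    (m : Fin (d + 1)) :
    HasLeadingTerm δ Q ((normPoly K ζ fun i => monomial (μ i) (1 : ℂ)).coeff (K * m))
      (ζ ^ (∑ i : Fin K, (i : ℕ) * (m : ℕ))) (K • μ m) := by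
  classical
  rw [HasLeadingTerm, coeff_normPoly, ← Finset.sum_erase_add _ _ (Finset.mem_univ fun _ => m)]
  have e : (if ∑ i : Fin K, (((fun _ => m) i : Fin (d + 1)) : ℕ) = K * m then
      ζ ^ (∑ i : Fin K, (i : ℕ) * (((fun _ => m) i : Fin (d + 1)) : ℕ)) •
        ∏ i : Fin K, monomial (μ ((fun _ => m) i)) (1 : ℂ) else 0) =
      monomial (K • μ m) (ζ ^ (∑ i : Fin K, (i : ℕ) * (m : ℕ))) := by
    simp [monomial_pow, smul_monomial]
  rw [e, add_sub_cancel_right]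
  refine Submodule.sum_mem _ fun a ha => ?_
  split_ifs with hs
  · refine Submodule.smul_mem _ _ ?_
    rw [← monomial_sum_one, monomial_mem_restrictSupport]
    left
    have hs' : ∑ i, ((a i : ℕ) : ℤ) = K * m := by exact_mod_cast hs
    obtain ⟨i₀, hi₀⟩ : ∃ i, a i ≠ m := by
      by_contra! hcon
      exact (Finset.mem_erase.1 ha).1 (funext hcon)
    refine ⟨?_, ?_⟩
    · simp only [map_sum, map_nsmul, hδ, Finset.sum_add_distrib, ← Finset.sum_smul, hs]
      simp [mul_smul, smul_add]
    · simp only [map_sum, map_nsmul, hQ]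
      have h1 : (0 : ℤ) < ∑ i, (((a i : ℕ) : ℤ) - m) ^ 2 := by
        refine Finset.sum_pos' (fun i _ => sq_nonneg _) ⟨i₀, Finset.mem_univ _, ?_⟩
        have : ((a i₀ : ℕ) : ℤ) - m ≠ 0 := by
          rw [sub_ne_zero]; exact_mod_cast fun h => hi₀ (Fin.ext h)
        positivity
      have h2 : ∑ i, (((a i : ℕ) : ℤ) - m) ^ 2 = ∑ i, ((a i : ℕ) : ℤ) ^ 2 - K * (m : ℤ) ^ 2 := by
        simp only [sub_sq, Finset.sum_add_distrib, Finset.sum_sub_distrib, ← Finset.sum_mul,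
          mul_assoc, ← Finset.mul_sum, hs']
        simp
        ring
      zify
      simp only [smul_eq_mul]
      push_cast
      linarith
  · exact zero_mem _

section Wheels

open MvPolynomial

/-- When `t` and `q` are primitive roots of unity of coprime orders `K` and `M`, the wheel condition
relative to `{t, t q, …, t q ^ (M - 1)}` only involves the `M`-th powers of the coordinates. -/
theorem satisfies_wheelSet_iff {K M : ℕ} (hK : 0 < K) (hM : 0 < M) (hKM : Nat.Coprime K M)
    {t q : ℂ} (ht : IsPrimitiveRoot t K) (hq : IsPrimitiveRoot q M) {n : ℕ}
    (f : MvPolynomial (Fin n) ℂ) :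
    Satisfies (wheelSet M q t) f ↔ ∀ (hn : K ≤ n) (x : Fin n → ℂ) (c : ℂ),
      (∀ i : Fin K, x (Fin.castLE hn i) ^ M = c * (t ^ M) ^ (i : ℕ)) → eval x f = 0 := by
  have hT : IsPrimitiveRoot (t ^ M) K := ht.pow_of_coprime M hKM.symm
  have ht0 : t ≠ 0 := ht.ne_zero hK.ne'
  constructor
  · intro hf hn x c hx
    obtain ⟨k, rfl⟩ : ∃ k, K = k + 1 := ⟨K - 1, by omega⟩
    by_cases hc : c = 0
    · have hx0 : ∀ i, x (Fin.castLE hn i) = 0 := fun i => by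
        have := hx i
        rw [hc, zero_mul] at this
        exact pow_eq_zero_iff hM.ne' |>.1 this
      refine hf (k + 1) (by omega) hn (fun _ => t) (fun _ => ⟨0, hM, by simp⟩) ?_ x ?_
      · simpa using ht.pow_eq_one
      · intro i; rw [hx0, hx0, mul_zero]
    · have hx0 : ∀ i, x (Fin.castLE hn i) ≠ 0 := fun i h0 => by
        have := hx i
        rw [h0, zero_pow hM.ne'] at this
        exact mul_ne_zero hc (pow_ne_zero _ (pow_ne_zero _ ht0)) this.symm
      refine hf (k + 1) (by omega) hn
        (fun i => x (Fin.castLE hn (finRotate (k + 1) i)) / x (Fin.castLE hn i)) ?_ ?_ x ?_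
      · intro i
        have h1 : x (Fin.castLE hn (finRotate (k + 1) i)) ^ M =
            t ^ M * x (Fin.castLE hn i) ^ M := by
          rw [hx, hx, coe_finRotate]
          split_ifs with h
          · subst h
            have := hT.pow_eq_one
            rw [pow_succ] at this
            simp only [Fin.val_last]
            linear_combination (-c) * this
          · rw [pow_succ]; ring
        have h2 : (x (Fin.castLE hn (finRotate (k + 1) i)) / x (Fin.castLE hn i) / t) ^ M = 1 := by
          rw [div_pow, div_pow, h1]
          have := hx0 i
          field_simp
        have : NeZero M := ⟨hM.ne'⟩
        obtain ⟨s, hs, hs'⟩ := hq.eq_pow_of_pow_eq_one h2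
        refine ⟨s, hs, ?_⟩
        rw [hs']
        field_simp
      · rw [Finset.prod_div_distrib,
          Equiv.prod_comp (finRotate (k + 1)) (fun i => x (Fin.castLE hn i))]
        exact div_self (Finset.prod_ne_zero_iff.2 fun i _ => hx0 i)
      · intro i
        have := hx0 i
        field_simp
  · intro hf l hl hln τ hτ hp x hx
    have hτM : ∀ i, τ i ^ M = t ^ M := by
      intro i
      obtain ⟨s, -, hs⟩ := hτ i
      rw [hs, mul_pow, ← pow_mul, mul_comm s M, pow_mul, hq.pow_eq_one, one_pow, mul_one]
    have hdvd : K ∣ l := by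
      rw [← hT.pow_eq_one_iff_dvd]
      have := congrArg (· ^ M) hp
      simpa [← Finset.prod_pow, hτM] using this
    have hKl : K ≤ l := Nat.le_of_dvd hl hdvd
    obtain ⟨l, rfl⟩ : ∃ k, l = k + 1 := ⟨l - 1, by omega⟩
    have key : ∀ (i : ℕ) (hi : i < l + 1), x (Fin.castLE hln ⟨i, hi⟩) ^ M =
        x (Fin.castLE hln ⟨0, by omega⟩) ^ M * (t ^ M) ^ i := by
      intro i
      induction i with
      | zero => intro hi; simp
      | succ i ih =>
        intro hi
        have h1 := hx ⟨i, by omega⟩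
        rw [finRotate_of_lt (by omega : i < l)] at h1
        rw [h1, mul_pow, hτM, ih (by omega), pow_succ]
        ring
    exact hf (hKl.trans hln) x _ fun i => key i (by omega)

end Wheels

section Exponents

open MvPolynomial

variable {ι : Type*}

theorem exists_sum_single_eq {n : ℕ} (γ : ι →₀ ℕ) (h : Finsupp.weight 1 γ = n) :
    ∃ s : Fin n → ι, ∑ i, Finsupp.single (s i) 1 = γ := by
  classical
  induction n generalizing γ with
  | zero =>
    have h0 : γ.degree = 0 := by rw [Finsupp.degree_eq_weight_one]; exact h
    rw [Finsupp.degree_eq_zero_iff] at h0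
    exact ⟨Fin.elim0, by simp [h0]⟩
  | succ n ih =>
    have hne : γ ≠ 0 := by rintro rfl; simp at h
    obtain ⟨i, hi⟩ := Finsupp.ne_iff.1 hne
    have hle : Finsupp.single i 1 ≤ γ := by
      rw [Finsupp.single_le_iff]; simp at hi; omega
    have e := tsub_add_cancel_of_le hle
    obtain ⟨s, hs⟩ := ih (γ - Finsupp.single i 1) (by
      have := congrArg (Finsupp.weight (1 : ι → ℕ)) e
      rw [map_add, h, Finsupp.weight_single] at this
      simpa using this)
    exact ⟨Fin.cons i s, by rw [Fin.sum_univ_succ]; simp [hs, add_comm _ (γ - _), e]⟩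

theorem exists_perm_of_sum_single_eq [DecidableEq ι] {n : ℕ} {s s' : Fin n → ι}
    (h : ∑ i, Finsupp.single (s i) 1 = ∑ i, Finsupp.single (s' i) (1 : ℕ)) :
    ∃ σ : Equiv.Perm (Fin n), ∀ i, s' (σ i) = s i := by
  have key : ∀ a, Nonempty ({i // s i = a} ≃ {i // s' i = a}) := by
    intro a
    have h1 := DFunLike.congr_fun h a
    simp only [Finsupp.finsetSum_apply, Finsupp.single_apply, Finset.sum_boole] at h1
    refine ⟨Fintype.equivOfCardEq ?_⟩
    rw [Fintype.card_subtype, Fintype.card_subtype]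
    exact_mod_cast h1
  exact ⟨Equiv.ofFiberEquiv fun a => (key a).some, fun i => Equiv.ofFiberEquiv_map _ _⟩

end Exponents

section OfFunctional

open MvPolynomial

variable {d : ℕ}

/-- The exponent of `∏ xᵢ ^ sᵢ`. -/
noncomputable def toExponent {n : ℕ} (s : Fin n → Fin (d + 1)) : Fin n →₀ ℕ :=
  Finsupp.equivFunOnFinite.symm fun i => (s i : ℕ)

@[simp]
theorem toExponent_apply {n : ℕ} (s : Fin n → Fin (d + 1)) (i : Fin n) :
    toExponent s i = s i := rfl

theorem toExponent_injective {n : ℕ} :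
    Function.Injective (toExponent : (Fin n → Fin (d + 1)) → Fin n →₀ ℕ) :=
  fun _ _ h => funext fun i => Fin.ext (DFunLike.congr_fun h i)

/-- The symmetric polynomial in `n` variables of degree at most `d` in each of them whose
coefficient at `∏ xᵢ ^ sᵢ` is the value of the functional `φ` at `∏ X_{sᵢ}`. -/
noncomputable def ofFunctional (n : ℕ) :
    (MvPolynomial (Fin (d + 1)) ℂ →ₗ[ℂ] ℂ) →ₗ[ℂ] MvPolynomial (Fin n) ℂ where
  toFun φ := ∑ s : Fin n → Fin (d + 1), monomial (toExponent s) (φ (∏ i, X (s i)))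
  map_add' φ ψ := by simp [Finset.sum_add_distrib]
  map_smul' c φ := by simp [Finset.smul_sum, smul_monomial]

variable (φ : MvPolynomial (Fin (d + 1)) ℂ →ₗ[ℂ] ℂ)

theorem ofFunctional_apply (n : ℕ) : ofFunctional n φ =
    ∑ s : Fin n → Fin (d + 1), monomial (toExponent s) (φ (∏ i, X (s i))) := rfl

theorem coeff_ofFunctional {n : ℕ} (s : Fin n → Fin (d + 1)) :
    coeff (toExponent s) (ofFunctional n φ) = φ (∏ i, X (s i)) := by
  rw [ofFunctional_apply, coeff_sum, Finset.sum_eq_single s]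
  · simp
  · intro b _ hb
    rw [coeff_monomial, if_neg fun h => hb (toExponent_injective h)]
  · simp

theorem exists_toExponent_eq_of_coeff_ne_zero {n : ℕ} {u : Fin n →₀ ℕ}
    (h : coeff u (ofFunctional n φ) ≠ 0) : ∃ s : Fin n → Fin (d + 1), toExponent s = u := by
  by_contra! hc
  refine h ?_
  rw [ofFunctional_apply, coeff_sum]
  exact Finset.sum_eq_zero fun s _ => by rw [coeff_monomial, if_neg (hc s)]

/-- The linear form `∑ cᵐ Xₘ`. -/
noncomputable def genForm (d : ℕ) (c : ℂ) : MvPolynomial (Fin (d + 1)) ℂ :=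
  ∑ m : Fin (d + 1), c ^ (m : ℕ) • X m

theorem eval_ofFunctional {n : ℕ} (x : Fin n → ℂ) :
    eval x (ofFunctional n φ) = φ (∏ i, genForm d (x i)) := by
  simp only [genForm, Finset.prod_univ_sum, Fintype.piFinset_univ, ofFunctional_apply, map_sum,
    Finset.prod_smul, map_smul, eval_monomial, smul_eq_mul]
  refine Finset.sum_congr rfl fun s _ => ?_
  rw [mul_comm, Finsupp.prod_fintype _ _ (by simp)]
  simp

theorem isSymmetric_ofFunctional (n : ℕ) : (ofFunctional n φ).IsSymmetric := by
  intro σ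
  refine MvPolynomial.funext fun x => ?_
  rw [eval_rename, eval_ofFunctional, eval_ofFunctional]
  simp only [Function.comp_apply]
  rw [Equiv.prod_comp σ (fun i => genForm d (x i))]

theorem genForm_eq_eval (c : ℂ) :
    genForm d c = (genPoly (X : Fin (d + 1) → MvPolynomial (Fin (d + 1)) ℂ)).eval (C c) := by
  rw [genForm, genPoly, Polynomial.eval_finsetSum]
  refine Finset.sum_congr rfl fun m _ => ?_
  rw [smul_eq_C_mul, Polynomial.eval_C_mul, Polynomial.eval_pow, Polynomial.eval_X, C_pow, mul_comm]

theorem prod_genForm (K : ℕ) (ζ c : ℂ) : ∏ i : Fin K, genForm d (c * ζ ^ (i : ℕ)) =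
    ∑ j ∈ Finset.range (K * d + 1),
      c ^ j • (normPoly K ζ (X : Fin (d + 1) → MvPolynomial (Fin (d + 1)) ℂ)).coeff j := by
  have h : ∏ i : Fin K, genForm d (c * ζ ^ (i : ℕ)) =
      (normPoly K ζ (X : Fin (d + 1) → MvPolynomial (Fin (d + 1)) ℂ)).eval (C c) := by
    rw [normPoly, Polynomial.eval_prod]
    refine Finset.prod_congr rfl fun i _ => ?_
    rw [genForm_eq_eval, Polynomial.eval_comp]
    simp [algebraMap_eq, mul_comm]
  rw [h, Polynomial.eval_eq_sum_range' (n := K * d + 1)]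
  · exact Finset.sum_congr rfl fun j _ => by rw [smul_eq_C_mul, C_pow, mul_comm]
  · rw [Nat.lt_succ_iff, Polynomial.natDegree_le_iff_coeff_eq_zero]
    exact fun j hj => coeff_normPoly_of_lt ζ _ hj

end OfFunctional

section Relations

open MvPolynomial

variable {d : ℕ}

/-- The number and the sum of the indices of a monomial in `X₀, …, X_d`. -/
noncomputable def bidegree (d : ℕ) : (Fin (d + 1) →₀ ℕ) →+ ℕ × ℕ :=
  (Finsupp.weight (1 : Fin (d + 1) → ℕ)).prod (Finsupp.weight fun i : Fin (d + 1) => (i : ℕ))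

/-- The sum of the squares of the indices of a monomial in `X₀, …, X_d`. -/
noncomputable def sqWeight (d : ℕ) : (Fin (d + 1) →₀ ℕ) →+ ℕ :=
  Finsupp.weight fun i : Fin (d + 1) => (i : ℕ) ^ 2

/-- The coefficient at `z ^ (K m)` of the product of the `∑ Xᵢ (ζ ^ j z) ^ i` over `j < K`. -/
noncomputable def relation (K : ℕ) (ζ : ℂ) (m : Fin (d + 1)) : MvPolynomial (Fin (d + 1)) ℂ :=
  (normPoly K ζ X).coeff (K * m)

theorem hasLeadingTerm_relation (K : ℕ) (ζ : ℂ) (m : Fin (d + 1)) :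
    HasLeadingTerm (bidegree d) (sqWeight d) (relation K ζ m)
      (ζ ^ (∑ i : Fin K, (i : ℕ) * (m : ℕ))) (Finsupp.single m K) := by
  have := hasLeadingTerm_coeff_normPoly (δ := bidegree d) (Q := sqWeight d)
    (fun m => Finsupp.single m 1) (A := (1, 0)) (B := (0, 1))
    (fun m => by simp [bidegree, Finsupp.weight_single])
    (fun m => by simp [sqWeight, Finsupp.weight_single]) K ζ m
  rw [Finsupp.smul_single, smul_eq_mul, mul_one] at this
  exact this

theorem functional_eq_zero {ι : Type*} {s : Set (ι →₀ ℕ)} {φ : MvPolynomial ι ℂ →ₗ[ℂ] ℂ}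
    (hφ : ∀ γ ∈ s, φ (monomial γ 1) = 0) {p : MvPolynomial ι ℂ} (hp : p ∈ restrictSupport ℂ s) :
    φ p = 0 := by
  rw [restrictSupport_eq_span] at hp
  have : Submodule.span ℂ ((monomial · 1) '' s) ≤ LinearMap.ker φ :=
    Submodule.span_le.2 (by rintro _ ⟨γ, hγ, rfl⟩; exact hφ γ hγ)
  exact this hp

theorem prod_X_eq_monomial {ι κ : Type*} [Fintype κ] (s : κ → ι) :
    ∏ i, (X (s i) : MvPolynomial ι ℂ) = monomial (∑ i, Finsupp.single (s i) 1) 1 :=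
  (monomial_sum_one _ _).symm

/-- The polynomial of a functional vanishes on the wheels if and only if the functional kills the
ideal of the relations. -/
theorem ofFunctional_vanishes_iff {K : ℕ} (hK : 0 < K) {T : ℂ} (hT : IsPrimitiveRoot T K) {n : ℕ}
    {φ : MvPolynomial (Fin (d + 1)) ℂ →ₗ[ℂ] ℂ}
    (hφ : ∀ γ, Finsupp.weight 1 γ ≠ n → φ (monomial γ 1) = 0) :
    (∀ (hn : K ≤ n) (x : Fin n → ℂ) (c : ℂ),
      (∀ i : Fin K, x (Fin.castLE hn i) = c * T ^ (i : ℕ)) → eval x (ofFunctional n φ) = 0) ↔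
      ∀ m p, φ (relation K T m * p) = 0 := by
  constructor
  · intro h m p
    suffices hs : φ ∘ₗ LinearMap.mulLeft ℂ (relation K T m) = 0 from LinearMap.congr_fun hs p
    refine linearMap_ext fun ν => LinearMap.ext_ring ?_
    simp only [LinearMap.comp_apply, LinearMap.mulLeft_apply, LinearMap.zero_apply]
    by_cases hν : K + Finsupp.weight 1 ν = n
    · obtain ⟨n', rfl⟩ : ∃ n', n = K + n' := ⟨n - K, by omega⟩
      obtain ⟨s, rfl⟩ := exists_sum_single_eq ν (by omega : Finsupp.weight 1 ν = n')
      have h1 : ∀ j (x : Fin n' → ℂ), φ ((normPoly K T X).coeff j * ∏ i, genForm d (x i)) = 0 := by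
        intro j x
        have h2 : ∑ j ∈ Finset.range (K * d + 1), Polynomial.C
            (φ ((normPoly K T X).coeff j * ∏ i, genForm d (x i))) * Polynomial.X ^ j = 0 := by
          refine Polynomial.funext fun c => ?_
          have h3 := h (by omega) (Fin.append (fun i => c * T ^ (i : ℕ)) x) c (fun i => by
            have : Fin.castLE (by omega : K ≤ K + n') i = Fin.castAdd n' i := rfl
            rw [this, Fin.append_left])
          rw [eval_ofFunctional, Fin.prod_univ_add] at h3
          simp only [Fin.append_left, Fin.append_right, prod_genForm, Finset.sum_mul,
            smul_mul_assoc, map_sum, map_smul, smul_eq_mul] at h3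
          rw [Polynomial.eval_finsetSum, Polynomial.eval_zero, ← h3]
          refine Finset.sum_congr rfl fun j _ => ?_
          rw [Polynomial.eval_mul, Polynomial.eval_C, Polynomial.eval_pow, Polynomial.eval_X,
            mul_comm]
        by_cases hj : j < K * d + 1
        · have := congrArg (fun p => Polynomial.coeff p j) h2
          simpa [Polynomial.finsetSum_coeff, Polynomial.coeff_X_pow, hj] using this
        · rw [coeff_normPoly_of_lt _ _ (by omega), zero_mul, map_zero]
      have h4 : ofFunctional n' (φ ∘ₗ LinearMap.mulLeft ℂ (relation K T m)) = 0 := by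
        refine MvPolynomial.funext fun x => ?_
        rw [eval_ofFunctional, map_zero]
        exact h1 _ x
      have := coeff_ofFunctional (φ ∘ₗ LinearMap.mulLeft ℂ (relation K T m)) s
      rw [h4, coeff_zero, prod_X_eq_monomial] at this
      exact this.symm
    · refine functional_eq_zero (fun γ hγ => hφ γ ?_)
        ((hasLeadingTerm_relation K T m).mul (HasLeadingTerm.monomial ν 1)).mem_restrictSupport
      have := congrArg Prod.fst hγ
      simp only [bidegree, AddMonoidHom.prod_apply, map_add, Finsupp.weight_single] at this
      rw [this]
      simpa using hν
  · intro h hn x c hx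
    obtain ⟨n', rfl⟩ : ∃ n', n = K + n' := ⟨n - K, by omega⟩
    have hx' : ∀ i, x (Fin.castAdd n' i) = c * T ^ (i : ℕ) := hx
    rw [eval_ofFunctional, Fin.prod_univ_add]
    simp only [hx', prod_genForm, Finset.sum_mul, smul_mul_assoc, map_sum, map_smul]
    refine Finset.sum_eq_zero fun j hj => ?_
    by_cases hd : K ∣ j
    · obtain ⟨m, rfl⟩ := hd
      have hm : m < d + 1 := by
        have := Finset.mem_range.1 hj
        have : K * m ≤ K * d := by omega
        have := Nat.le_of_mul_le_mul_left this hK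
        omega
      have := h ⟨m, hm⟩ (∏ i : Fin n', genForm d (x (Fin.natAdd K i)))
      rw [relation] at this
      rw [this, smul_zero]
    · rw [coeff_normPoly_of_not_dvd hK hT _ hd, zero_mul, map_zero, smul_zero]

end Relations

section Dimension

open MvPolynomial

variable {d K : ℕ} {T : ℂ}

theorem hasLeadingTerm_adapted_relation (K : ℕ) (T : ℂ) (γ : Fin (d + 1) →₀ ℕ) :
    HasLeadingTerm (bidegree d) (sqWeight d) (adapted K (relation K T) γ)
      (∏ m : Fin (d + 1), (T ^ (∑ i : Fin K, (i : ℕ) * (m : ℕ))) ^ (γ m / K)) γ :=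
  HasLeadingTerm.adapted (hasLeadingTerm_relation K T) γ

theorem sqWeight_le (γ : Fin (d + 1) →₀ ℕ) : sqWeight d γ ≤ d * (bidegree d γ).2 := by
  simp only [sqWeight, bidegree, AddMonoidHom.prod_apply, Finsupp.weight_apply]
  rw [Finsupp.sum_fintype _ _ (by simp), Finsupp.sum_fintype _ _ (by simp), Finset.mul_sum]
  refine Finset.sum_le_sum fun i _ => ?_
  have : (i : ℕ) ≤ d := by omega
  simp only [smul_eq_mul]
  nlinarith [Nat.mul_le_mul_left (γ i * (i : ℕ)) this]

theorem leadingCoeff_adapted_ne_zero (hT : T ≠ 0) (γ : Fin (d + 1) →₀ ℕ) :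
    ∏ m : Fin (d + 1), (T ^ (∑ i : Fin K, (i : ℕ) * (m : ℕ))) ^ (γ m / K) ≠ 0 :=
  Finset.prod_ne_zero_iff.2 fun _ _ => pow_ne_zero _ (pow_ne_zero _ hT)

theorem monomial_mem_span_adapted (hT : T ≠ 0) (γ : Fin (d + 1) →₀ ℕ) :
    monomial γ (1 : ℂ) ∈ Submodule.span ℂ
      (adapted K (relation K T) '' {m | bidegree d m = bidegree d γ}) :=
  monomial_mem_span_of_hasLeadingTerm (leadingCoeff_adapted_ne_zero hT)
    (hasLeadingTerm_adapted_relation K T) (B := fun D => d * D.2) sqWeight_le γ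

/-- The basis `∏ Xᵢ ^ (γᵢ % K) Pᵢ ^ (γᵢ / K)`, where the `Pᵢ` are the relations. -/
noncomputable def adaptedBasis (d K : ℕ) (hT : T ≠ 0) :
    Module.Basis (Fin (d + 1) →₀ ℕ) ℂ (MvPolynomial (Fin (d + 1)) ℂ) :=
  Module.Basis.mk (v := adapted K (relation K T))
    (linearIndependent_of_hasLeadingTerm (leadingCoeff_adapted_ne_zero hT)
      (hasLeadingTerm_adapted_relation K T)) (by
    rw [← (basisMonomials (Fin (d + 1)) ℂ).span_eq, Submodule.span_le]
    rintro _ ⟨γ, rfl⟩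
    rw [coe_basisMonomials]
    exact Submodule.span_mono (Set.image_subset_range _ _) (monomial_mem_span_adapted hT γ))

@[simp]
theorem adaptedBasis_apply (hT : T ≠ 0) (γ : Fin (d + 1) →₀ ℕ) :
    adaptedBasis d K hT γ = adapted K (relation K T) γ := by
  simp [adaptedBasis]

variable {φ : MvPolynomial (Fin (d + 1)) ℂ →ₗ[ℂ] ℂ}

theorem functional_homogeneous_iff (hT : T ≠ 0) (D : ℕ × ℕ) :
    (∀ γ, bidegree d γ ≠ D → φ (monomial γ 1) = 0) ↔
      ∀ γ, bidegree d γ ≠ D → φ (adapted K (relation K T) γ) = 0 := by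
  constructor
  · intro h γ hγ
    refine functional_eq_zero (fun m hm => h m ?_)
      (hasLeadingTerm_adapted_relation K T γ).mem_restrictSupport
    rw [show bidegree d m = bidegree d γ from hm]
    exact hγ
  · intro h γ hγ
    have : Submodule.span ℂ (adapted K (relation K T) '' {m | bidegree d m = bidegree d γ}) ≤
        LinearMap.ker φ := by
      refine Submodule.span_le.2 ?_
      rintro _ ⟨m, hm, rfl⟩
      exact h m (by rw [show bidegree d m = bidegree d γ from hm]; exact hγ)
    exact this (monomial_mem_span_adapted hT γ)

theorem functional_relation_iff (hK : 0 < K) (hT : T ≠ 0) :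
    (∀ m p, φ (relation K T m * p) = 0) ↔
      ∀ γ : Fin (d + 1) →₀ ℕ, (∃ i, K ≤ γ i) → φ (adapted K (relation K T) γ) = 0 := by
  constructor
  · rintro h γ ⟨i, hi⟩
    have e : γ - Finsupp.single i K + Finsupp.single i K = γ :=
      tsub_add_cancel_of_le (Finsupp.single_le_iff.2 hi)
    rw [← e, ← mul_adapted hK]
    exact h i _
  · intro h m p
    suffices hs : φ ∘ₗ LinearMap.mulLeft ℂ (relation K T m) = 0 from LinearMap.congr_fun hs p
    refine (adaptedBasis d K hT).ext fun γ => ?_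
    simp only [LinearMap.comp_apply, LinearMap.mulLeft_apply, LinearMap.zero_apply,
      adaptedBasis_apply, mul_adapted hK]
    exact h _ ⟨m, by simp⟩

theorem bidegree_sum_single {n : ℕ} (s : Fin n → Fin (d + 1)) :
    bidegree d (∑ i, Finsupp.single (s i) 1) = (n, (toExponent s).degree) := by
  rw [map_sum, Finsupp.degree_eq_sum]
  simp [bidegree, Finsupp.weight_single, Prod.ext_iff, Prod.fst_sum, Prod.snd_sum]

theorem isHomogeneous_ofFunctional {n : ℕ}
    (hφ : ∀ γ, bidegree d γ ≠ (n, d) → φ (monomial γ 1) = 0) :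
    (ofFunctional n φ).IsHomogeneous d := by
  intro u hu
  obtain ⟨s, rfl⟩ := exists_toExponent_eq_of_coeff_ne_zero φ hu
  rw [coeff_ofFunctional, prod_X_eq_monomial] at hu
  by_contra hne
  refine hu (hφ _ fun h => hne ?_)
  rw [bidegree_sum_single] at h
  have := (Prod.ext_iff.1 h).2
  rwa [Finsupp.degree_eq_weight_one] at this

theorem coeff_eq_of_isSymmetric {n : ℕ} {f : MvPolynomial (Fin n) ℂ} (hf : f.IsSymmetric)
    {s s' : Fin n → Fin (d + 1)}
    (h : ∑ i, Finsupp.single (s i) 1 = ∑ i, Finsupp.single (s' i) (1 : ℕ)) :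
    coeff (toExponent s) f = coeff (toExponent s') f := by
  obtain ⟨σ, hσ⟩ := exists_perm_of_sum_single_eq h
  rw [← coeff_rename_mapDomain σ σ.injective f (toExponent s), hf σ]
  congr 1
  ext i
  rw [← σ.apply_symm_apply i, Finsupp.mapDomain_apply σ.injective]
  simp [← hσ]

/-- Every symmetric homogeneous polynomial of degree `d` is the polynomial of a functional. -/
theorem exists_ofFunctional_eq {n : ℕ} {f : MvPolynomial (Fin n) ℂ} (hf : f.IsSymmetric)
    (hd : f.IsHomogeneous d) : ∃ φ : MvPolynomial (Fin (d + 1)) ℂ →ₗ[ℂ] ℂ,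
      (∀ γ, bidegree d γ ≠ (n, d) → φ (monomial γ 1) = 0) ∧ ofFunctional n φ = f := by
  classical
  have hex : ∀ γ, bidegree d γ = (n, d) → ∃ s : Fin n → Fin (d + 1),
      ∑ i, Finsupp.single (s i) 1 = γ := fun γ hγ =>
    exists_sum_single_eq γ (Prod.ext_iff.1 hγ).1
  let φ := (basisMonomials (Fin (d + 1)) ℂ).constr ℂ fun γ =>
    if h : bidegree d γ = (n, d) then coeff (toExponent (hex γ h).choose) f else 0
  have hφ : ∀ γ, φ (monomial γ 1) =
      if h : bidegree d γ = (n, d) then coeff (toExponent (hex γ h).choose) f else 0 := by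
    intro γ
    rw [← (basisMonomials (Fin (d + 1)) ℂ).constr_basis ℂ (fun γ => if h : bidegree d γ = (n, d)
      then coeff (toExponent (hex γ h).choose) f else 0) γ, coe_basisMonomials]
  refine ⟨φ, fun γ hγ => by rw [hφ, dif_neg hγ], ?_⟩
  ext u
  by_cases hu : ∃ s : Fin n → Fin (d + 1), toExponent s = u
  · obtain ⟨s, rfl⟩ := hu
    rw [coeff_ofFunctional, prod_X_eq_monomial, hφ]
    split_ifs with h
    · exact coeff_eq_of_isSymmetric hf (hex _ h).choose_spec
    · rw [bidegree_sum_single] at h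
      symm
      exact hd.coeff_eq_zero fun h' => h (by rw [h'])
  · have h1 : coeff u (ofFunctional n φ) = 0 := by
      by_contra hne
      exact hu (exists_toExponent_eq_of_coeff_ne_zero φ hne)
    rw [h1]
    symm
    refine hd.coeff_eq_zero fun h' => hu ⟨fun i => ⟨u i, ?_⟩, ?_⟩
    · have := Finsupp.le_degree i u
      omega
    · ext i; rfl

/-- The exponents of size `n` and weight `d` with entries smaller than `K`. -/
def boundedExponents (K n d : ℕ) : Set (Fin (d + 1) →₀ ℕ) :=
  {γ | bidegree d γ = (n, d) ∧ ∀ i, γ i < K}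

instance (K n d : ℕ) : Finite (boundedExponents K n d) :=
  Finite.of_injective (fun γ i => (⟨γ.1 i, γ.2.2 i⟩ : Fin K)) fun _ _ h =>
    Subtype.ext (Finsupp.ext fun i => congrArg Fin.val (congrFun h i))

theorem finrank_gradedPiece (hK : 0 < K) (hT : IsPrimitiveRoot T K) (n d : ℕ) :
    Module.finrank ℂ (gradedPiece (wheelSet 1 1 T) n d) = Nat.card (boundedExponents K n d) := by
  classical
  have hT0 : T ≠ 0 := hT.ne_zero hK.ne'
  have hsat : ∀ {φ : MvPolynomial (Fin (d + 1)) ℂ →ₗ[ℂ] ℂ},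
      (∀ γ, bidegree d γ ≠ (n, d) → φ (monomial γ 1) = 0) →
      (Satisfies (wheelSet 1 1 T) (ofFunctional n φ) ↔
        ∀ γ : Fin (d + 1) →₀ ℕ, (∃ i, K ≤ γ i) → φ (adapted K (relation K T) γ) = 0) := by
    intro φ hφ
    rw [satisfies_wheelSet_iff hK one_pos (Nat.coprime_one_right K) hT IsPrimitiveRoot.one,
      ← functional_relation_iff hK hT0, ← ofFunctional_vanishes_iff hK hT (n := n)]
    · simp
    · intro γ hγ
      exact hφ γ fun h => hγ (Prod.ext_iff.1 h).1
  let b := adaptedBasis d K hT0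
  let Θ : (boundedExponents K n d → ℂ) →ₗ[ℂ] MvPolynomial (Fin n) ℂ :=
    ofFunctional n ∘ₗ (b.constr ℂ).toLinearMap ∘ₗ
      Function.ExtendByZero.linearMap ℂ (Subtype.val : boundedExponents K n d → _)
  have hval : ∀ (ψ : boundedExponents K n d → ℂ) γ, b.constr ℂ
      (Function.extend Subtype.val ψ 0) (adapted K (relation K T) γ) =
        if h : γ ∈ boundedExponents K n d then ψ ⟨γ, h⟩ else 0 := by
    intro ψ γ
    have h1 := b.constr_basis ℂ (Function.extend Subtype.val ψ 0) γ
    rw [adaptedBasis_apply] at h1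
    rw [h1]
    split_ifs with h
    · exact Subtype.val_injective.extend_apply ψ 0 ⟨γ, h⟩
    · exact Function.extend_apply' _ _ _ fun ⟨a, ha⟩ => h (ha ▸ a.2)
  have hhom : ∀ ψ : boundedExponents K n d → ℂ, ∀ γ, bidegree d γ ≠ (n, d) →
      b.constr ℂ (Function.extend Subtype.val ψ 0) (monomial γ 1) = 0 := by
    intro ψ
    rw [functional_homogeneous_iff (K := K) hT0]
    intro γ hγ
    rw [hval, dif_neg fun h => hγ h.1]
  have hinj : Function.Injective Θ := by
    rw [← LinearMap.ker_eq_bot, LinearMap.ker_eq_bot']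
    intro ψ hψ
    have hψ' : ofFunctional n (b.constr ℂ (Function.extend Subtype.val ψ 0)) = 0 := hψ
    have h0 : b.constr ℂ (Function.extend Subtype.val ψ 0) = 0 := by
      refine linearMap_ext fun γ => LinearMap.ext_ring ?_
      simp only [LinearMap.comp_apply, LinearMap.zero_apply]
      by_cases hγ : bidegree d γ = (n, d)
      · obtain ⟨s, rfl⟩ := exists_sum_single_eq γ (Prod.ext_iff.1 hγ).1
        rw [← prod_X_eq_monomial, ← coeff_ofFunctional, hψ', coeff_zero]
      · exact hhom ψ γ hγ
    ext γ
    have := hval ψ γ.1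
    rw [h0, dif_pos γ.2] at this
    exact this.symm
  have hrange : LinearMap.range Θ = gradedPiece (wheelSet 1 1 T) n d := by
    ext f
    constructor
    · rintro ⟨ψ, rfl⟩
      have e : Θ ψ = ofFunctional n (b.constr ℂ (Function.extend Subtype.val ψ 0)) := rfl
      rw [e]
      refine ⟨⟨isSymmetric_ofFunctional _ _, (hsat (hhom ψ)).2 ?_⟩,
        isHomogeneous_ofFunctional (hhom ψ)⟩
      rintro γ ⟨i, hi⟩
      rw [hval, dif_neg fun h => (h.2 i).not_ge hi]
    · rintro ⟨⟨hsym, hs⟩, hd⟩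
      obtain ⟨φ, hφ, rfl⟩ := exists_ofFunctional_eq hsym hd
      let ψ : boundedExponents K n d → ℂ := fun γ => φ (adapted K (relation K T) γ.1)
      have e : b.constr ℂ (Function.extend Subtype.val ψ 0) = φ := by
        refine b.ext fun γ => ?_
        rw [adaptedBasis_apply, hval]
        split_ifs with h
        · rfl
        · symm
          by_cases hγ : bidegree d γ = (n, d)
          · refine (hsat hφ).1 hs γ ?_
            by_contra! hlt
            exact h ⟨hγ, hlt⟩
          · exact (functional_homogeneous_iff hT0 _).1 hφ γ hγ
      exact ⟨ψ, congrArg (ofFunctional n) e⟩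
  have := Fintype.ofFinite (boundedExponents K n d)
  rw [← hrange, LinearMap.finrank_range_of_inj hinj, Module.finrank_fintype_fun_eq_card,
    Nat.card_eq_fintype_card]

end Dimension

section Counting

open PowerSeries

/-- The power series `∏_{m < L} ∑_{j < K} (v ^ m z) ^ j` in `z` over the power series in `v`. -/
noncomputable def boundedSeries (K L : ℕ) : PowerSeries (PowerSeries ℚ) :=
  ∏ m : Fin L, ∑ j : Fin K, (C (X ^ (m : ℕ)) * X) ^ (j : ℕ)

theorem coeff_boundedSeries (K L n : ℕ) : coeff n (boundedSeries K L) =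
    ∑ α : Fin L → Fin K, if ∑ m, (α m : ℕ) = n then X ^ (∑ m : Fin L, (m : ℕ) * (α m : ℕ))
      else 0 := by
  rw [boundedSeries, Finset.prod_univ_sum, Fintype.piFinset_univ, map_sum]
  refine Finset.sum_congr rfl fun α _ => ?_
  simp only [mul_pow, Finset.prod_mul_distrib, ← map_pow, ← pow_mul]
  rw [← map_prod, Finset.prod_pow_eq_pow_sum, Finset.prod_pow_eq_pow_sum, coeff_C_mul, coeff_X_pow]
  simp only [mul_ite, mul_one, mul_zero, eq_comm]

theorem card_boundedExponents (K n d : ℕ) : (Nat.card (boundedExponents K n d) : ℚ) =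
    coeff d (coeff n (boundedSeries K (d + 1))) := by
  classical
  rw [coeff_boundedSeries, map_sum]
  have h : ∀ α : Fin (d + 1) → Fin K, coeff d ((if ∑ m, (α m : ℕ) = n then
      X ^ (∑ m : Fin (d + 1), (m : ℕ) * (α m : ℕ)) else 0 : PowerSeries ℚ)) =
      if ∑ m, (α m : ℕ) = n ∧ ∑ m : Fin (d + 1), (m : ℕ) * (α m : ℕ) = d then 1 else 0 := by
    intro α
    split_ifs with h1 h2 h2
    · rw [coeff_X_pow, if_pos h2.2.symm]
    · rw [coeff_X_pow, if_neg fun h => h2 ⟨h1, h.symm⟩]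
    · exact absurd h2.1 h1
    · simp
  rw [Finset.sum_congr rfl fun α _ => h α, Finset.sum_boole, ← Fintype.card_subtype,
    ← Nat.card_eq_fintype_card]
  congr 1
  have hbi : ∀ γ : Fin (d + 1) →₀ ℕ, bidegree d γ =
      (∑ m, γ m, ∑ m : Fin (d + 1), (m : ℕ) * γ m) := by
    intro γ
    simp only [bidegree, AddMonoidHom.prod_apply, Finsupp.weight_apply]
    rw [Finsupp.sum_fintype _ _ (by simp), Finsupp.sum_fintype _ _ (by simp)]
    simp [mul_comm]
  refine Nat.card_congr
    { toFun := fun γ => ⟨fun i => ⟨γ.1 i, γ.2.2 i⟩, ?_⟩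
      invFun := fun α => ⟨Finsupp.equivFunOnFinite.symm fun i => (α.1 i : ℕ), ?_, ?_⟩
      left_inv := fun γ => by ext; rfl
      right_inv := fun α => by ext; rfl }
  · have := γ.2.1
    rw [hbi] at this
    exact Prod.ext_iff.1 this
  · rw [hbi]
    exact Prod.ext_iff.2 α.2
  · exact fun i => (α.1 i).2

theorem boundedSeries_functional_equation (K L : ℕ) :
    (1 - X) * boundedSeries K (L + 1) =
      (1 - X ^ K) * rescale (X : PowerSeries ℚ) (boundedSeries K L) := by
  have h : rescale (X : PowerSeries ℚ) (boundedSeries K L) =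
      ∏ m : Fin L, ∑ j : Fin K, (C (X ^ ((m : ℕ) + 1)) * X) ^ (j : ℕ) := by
    simp only [boundedSeries, map_prod, map_sum, map_pow, map_mul, rescale_X]
    refine Finset.prod_congr rfl fun m _ => Finset.sum_congr rfl fun j _ => ?_
    have : rescale (X : PowerSeries ℚ) (C X) = C X := by
      ext n : 1
      rw [coeff_rescale, coeff_C]
      split_ifs with h
      · simp [h]
      · simp
    rw [this, pow_succ]
    ring
  rw [h, boundedSeries, Fin.prod_univ_succ, ← mul_assoc]
  congr 1
  rw [Fin.sum_univ_eq_sum_range (fun j => (C (X ^ ((0 : Fin (L + 1)) : ℕ)) * X) ^ j) K]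
  simp only [Fin.val_zero, pow_zero, map_one, one_mul]
  exact mul_neg_geom_sum _ _

theorem dvd_coeff_boundedSeries_succ_sub {K : ℕ} (hK : 0 < K) (L n : ℕ) :
    X ^ L ∣ coeff n (boundedSeries K (L + 1)) - coeff n (boundedSeries K L) := by
  obtain ⟨k, rfl⟩ : ∃ k, K = k + 1 := ⟨K - 1, by omega⟩
  have h : boundedSeries (k + 1) (L + 1) - boundedSeries (k + 1) L =
      C (X ^ L) * (boundedSeries (k + 1) L *
        ∑ j : Fin k, (C (X ^ L) * X) ^ (j : ℕ) * X) := by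
    rw [boundedSeries, Fin.prod_univ_castSucc, Fin.sum_univ_succ]
    simp only [Fin.val_castSucc, Fin.val_last, Fin.val_zero, Fin.val_succ, pow_zero]
    rw [← boundedSeries, mul_add, mul_one, add_sub_cancel_left, mul_left_comm]
    congr 1
    rw [Finset.mul_sum]
    refine Finset.sum_congr rfl fun j _ => ?_
    rw [pow_succ]; ring
  rw [← map_sub, h, coeff_C_mul]
  exact dvd_mul_right _ _

theorem coeff_zero_boundedSeries {K : ℕ} (hK : 0 < K) (L : ℕ) :
    coeff 0 (boundedSeries K L) = 1 := by
  obtain ⟨k, rfl⟩ : ∃ k, K = k + 1 := ⟨K - 1, by omega⟩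
  rw [boundedSeries, coeff_zero_eq_constantCoeff_apply, map_prod]
  refine Finset.prod_eq_one fun m _ => ?_
  rw [map_sum, Fin.sum_univ_succ]
  simp

theorem isUnit_one_sub_X_pow {n : ℕ} (hn : n ≠ 0) : IsUnit (1 - X ^ n : PowerSeries ℚ) := by
  rw [PowerSeries.isUnit_iff_constantCoeff]
  simp [hn]

/-- The functional equation determines a power series up to its constant coefficient. -/
theorem dvd_coeff_of_functional_equation {K L : ℕ} (hK : 0 < K) {F E : PowerSeries (PowerSeries ℚ)}
    (h0 : X ^ L ∣ coeff 0 F) (hE : ∀ n, X ^ L ∣ coeff n E)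
    (h : (1 - X) * F + E = (1 - X ^ K) * rescale (X : PowerSeries ℚ) F) (n : ℕ) :
    X ^ L ∣ coeff n F := by
  induction n using Nat.strong_induction_on with
  | _ n ih =>
  rcases n with _ | n
  · exact h0
  have h1 := congrArg (coeff (n + 1)) h
  rw [sub_mul, sub_mul, map_add, map_sub, map_sub, one_mul, one_mul, coeff_succ_X_mul,
    coeff_X_pow_mul', coeff_rescale] at h1
  rw [← (isUnit_one_sub_X_pow n.succ_ne_zero).dvd_mul_left]
  have h2 : (1 - X ^ (n + 1)) * coeff (n + 1) F = coeff n F - coeff (n + 1) E -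
      (if K ≤ n + 1 then coeff (n + 1 - K) (rescale (X : PowerSeries ℚ) F) else 0) := by
    linear_combination h1
  rw [h2]
  refine dvd_sub (dvd_sub (ih n (by omega)) (hE _)) ?_
  split_ifs with hle
  · rw [coeff_rescale]
    exact Dvd.dvd.mul_left (ih _ (by omega)) _
  · exact dvd_zero _

/-- The generating series of the `(-1)^a v^{(k+1)a(a-1)/2} / ∏_{i=1}^a (1-v^{(k+1)i})`, placed in
degree `(k+1)a`. -/
noncomputable def signedSeries (k : ℕ) : PowerSeries (PowerSeries ℚ) :=
  mk fun n => if k + 1 ∣ n then (-1) ^ (n / (k + 1)) *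
    X ^ ((k + 1) * (n / (k + 1)) * (n / (k + 1) - 1) / 2) *
      (∏ i ∈ Finset.Icc 1 (n / (k + 1)), (1 - X ^ ((k + 1) * i)))⁻¹ else 0

/-- The generating series of the `1 / ∏_{j=1}^b (1-v^j)`. -/
noncomputable def partitionSeries : PowerSeries (PowerSeries ℚ) :=
  mk fun n => (∏ j ∈ Finset.Icc 1 n, (1 - X ^ j))⁻¹

theorem coeff_signedSeries_mul_partitionSeries (k n : ℕ) :
    coeff n (signedSeries k * partitionSeries) = bCoeff k n := by
  rw [coeff_mul, bCoeff]
  symm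
  refine Finset.sum_of_injOn (fun p => ((k + 1) * p.1, p.2)) ?_ ?_ ?_ ?_
  · rintro ⟨a, b⟩ _ ⟨a', b'⟩ _ h
    simpa using h
  · rintro ⟨a, b⟩ h
    simp only [Finset.coe_filter, Set.mem_ofPred_eq] at h
    simpa using h.2
  · rintro ⟨u, b⟩ h hu
    simp only [signedSeries, coeff_mk]
    rw [if_neg, zero_mul]
    rintro ⟨a, rfl⟩
    rw [Finset.HasAntidiagonal.mem_antidiagonal] at h
    dsimp only at h
    refine hu ⟨(a, b), ?_, rfl⟩
    simp only [Finset.coe_filter, Set.mem_ofPred_eq, Finset.mem_product, Finset.mem_range]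
    exact ⟨⟨by nlinarith, by nlinarith⟩, h⟩
  · rintro ⟨a, b⟩ h
    simp only [signedSeries, partitionSeries, coeff_mk, dvd_mul_right, if_true]
    rw [Nat.mul_div_cancel_left _ (by omega), PowerSeries.mul_inv_rev]
    ring

theorem rescale_partitionSeries :
    rescale (X : PowerSeries ℚ) partitionSeries = (1 - X) * partitionSeries := by
  ext n : 1
  rw [coeff_rescale, sub_mul, one_mul, map_sub]
  rcases n with _ | n
  · simp
  · rw [coeff_succ_X_mul]
    simp only [partitionSeries, coeff_mk]
    rw [Finset.prod_Icc_succ_top (by omega), PowerSeries.mul_inv_rev]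
    have : (1 - X ^ (n + 1) : PowerSeries ℚ) * (1 - X ^ (n + 1))⁻¹ = 1 :=
      PowerSeries.mul_inv_cancel _ (by simp)
    linear_combination (- (∏ j ∈ Finset.Icc 1 n, (1 - X ^ j : PowerSeries ℚ))⁻¹) * this

theorem signedSeries_eq (k : ℕ) :
    signedSeries k = (1 - X ^ (k + 1)) * rescale (X : PowerSeries ℚ) (signedSeries k) := by
  ext n : 1
  rw [sub_mul, one_mul, map_sub, coeff_X_pow_mul', coeff_rescale, coeff_rescale]
  by_cases hd : k + 1 ∣ n
  · obtain ⟨a, rfl⟩ := hd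
    rcases a with _ | a
    · simp
    · have hle : k + 1 ≤ (k + 1) * (a + 1) := by nlinarith
      have hs : (k + 1) * (a + 1) - (k + 1) = (k + 1) * a := by
        rw [mul_add, mul_one, Nat.add_sub_cancel]
      rw [if_pos hle, hs]
      simp only [signedSeries, coeff_mk, dvd_mul_right, if_true,
        Nat.mul_div_cancel_left _ (Nat.succ_pos k)]
      rw [Finset.prod_Icc_succ_top (by omega), PowerSeries.mul_inv_rev]
      have : (1 - X ^ ((k + 1) * (a + 1)) : PowerSeries ℚ) *
          (1 - X ^ ((k + 1) * (a + 1)))⁻¹ = 1 := PowerSeries.mul_inv_cancel _ (by simp)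
      have he : (k + 1) * (a + 1) * (a + 1 - 1) / 2 =
          (k + 1) * a + (k + 1) * a * (a - 1) / 2 := by
        have : (k + 1) * (a + 1) * (a + 1 - 1) = (k + 1) * a * (a - 1) + 2 * ((k + 1) * a) := by
          rcases a with _ | a
          · simp
          · simp only [Nat.add_sub_cancel]; ring
        rw [this, Nat.add_mul_div_left _ _ (by omega), add_comm]
      rw [he, pow_add (X : PowerSeries ℚ) _ ((k + 1) * a * (a - 1) / 2)]
      set u := (∏ j ∈ Finset.Icc 1 a, (1 - X ^ ((k + 1) * j) : PowerSeries ℚ))⁻¹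
      set w := (1 - X ^ ((k + 1) * (a + 1)) : PowerSeries ℚ)⁻¹
      set x := (X : PowerSeries ℚ) ^ ((k + 1) * a * (a - 1) / 2)
      set y := (X : PowerSeries ℚ) ^ ((k + 1) * a)
      linear_combination ((-1) ^ (a + 1) * y * x * u) * this
  · have h1 : coeff n (signedSeries k) = 0 := by simp [signedSeries, hd]
    rw [h1]
    split_ifs with hle
    · have h2 : coeff (n - (k + 1)) (signedSeries k) = 0 := by
        have : ¬ k + 1 ∣ n - (k + 1) := fun h => hd (by
          have := Nat.dvd_add h (dvd_refl (k + 1))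
          rwa [Nat.sub_add_cancel hle] at this)
        simp [signedSeries, this]
      rw [h2]; simp
    · simp

theorem coeff_zero_bCoeff (k : ℕ) : bCoeff k 0 = 1 := by
  rw [← coeff_signedSeries_mul_partitionSeries, coeff_zero_eq_constantCoeff_apply, map_mul]
  simp [← coeff_zero_eq_constantCoeff_apply, signedSeries, partitionSeries]

theorem card_boundedExponents_eq_coeff_bCoeff (k n d : ℕ) :
    (Nat.card (boundedExponents (k + 1) n d) : ℚ) = coeff d (bCoeff k n) := by
  rw [card_boundedExponents]
  have hB : (1 - X) * (signedSeries k * partitionSeries) =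
      (1 - X ^ (k + 1)) * rescale (X : PowerSeries ℚ) (signedSeries k * partitionSeries) := by
    rw [map_mul, rescale_partitionSeries, mul_left_comm, ← mul_assoc (1 - X ^ (k + 1)),
      ← signedSeries_eq]
  have h := dvd_coeff_of_functional_equation (K := k + 1) (L := d + 1) (Nat.succ_pos k)
    (F := boundedSeries (k + 1) (d + 1) - signedSeries k * partitionSeries)
    (E := (1 - X) * (boundedSeries (k + 1) (d + 2) - boundedSeries (k + 1) (d + 1)))
    (by rw [map_sub, coeff_zero_boundedSeries (Nat.succ_pos k),
      coeff_signedSeries_mul_partitionSeries, coeff_zero_bCoeff, sub_self]; exact dvd_zero _)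
    (fun n => by
      have hd := dvd_coeff_boundedSeries_succ_sub (Nat.succ_pos k) (d + 1)
      rw [sub_mul, one_mul, map_sub, map_sub]
      refine dvd_sub (hd n) ?_
      rcases n with _ | n
      · simp
      · rw [coeff_succ_X_mul, map_sub]; exact hd n)
    (by
      have := boundedSeries_functional_equation (k + 1) (d + 1)
      rw [map_sub]
      linear_combination this - hB) n
  rw [map_sub, coeff_signedSeries_mul_partitionSeries] at h
  have := X_pow_dvd_iff.1 h d (by omega)
  rw [map_sub, sub_eq_zero] at this
  exact this

end Counting

section PowerExpansion

open MvPolynomial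

theorem prod_sub_pow_mul {A : Type*} [CommRing A] [IsDomain A] {M : ℕ} (hM : 0 < M) {ζ : A}
    (hζ : IsPrimitiveRoot ζ M) (x y : A) : ∏ j : Fin M, (x - ζ ^ (j : ℕ) * y) = x ^ M - y ^ M := by
  have : NeZero M := ⟨hM.ne'⟩
  rw [hζ.pow_sub_pow_eq_prod_sub_mul x y hM]
  refine Finset.prod_nbij (fun j => ζ ^ (j : ℕ)) ?_ ?_ ?_ fun _ _ => rfl
  · intro j _
    rw [Polynomial.mem_nthRootsFinset hM, ← pow_mul, mul_comm, pow_mul, hζ.pow_eq_one, one_pow]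
  · intro i _ j _ h
    exact Fin.ext (hζ.pow_inj i.2 j.2 h)
  · intro w hw
    obtain ⟨i, hi, rfl⟩ := hζ.eq_pow_of_pow_eq_one ((Polynomial.mem_nthRootsFinset hM 1).1 hw)
    exact ⟨⟨i, hi⟩, by simp, rfl⟩

theorem normPoly_map {R S : Type*} [CommRing R] [Algebra ℂ R] [CommRing S] [Algebra ℂ S]
    (g : R →ₐ[ℂ] S) {d : ℕ} (K : ℕ) (ζ : ℂ) (x : Fin (d + 1) → R) (j : ℕ) :
    g ((normPoly K ζ x).coeff j) = (normPoly K ζ fun i => g (x i)).coeff j := by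
  simp only [coeff_normPoly, map_sum, apply_ite g, map_smul, map_prod, map_zero]

variable {n : ℕ}

theorem genPoly_esymm :
    genPoly (fun m : Fin (n + 1) => esymm (Fin n) ℂ m) =
      ∏ i, (1 + Polynomial.C (X i) * Polynomial.X) := by
  rw [Finset.prod_one_add, Finset.sum_powerset, genPoly, Finset.card_univ, Fintype.card_fin,
    Finset.sum_range]
  refine Finset.sum_congr rfl fun m _ => ?_
  rw [esymm, map_sum, Finset.sum_mul]
  refine Finset.sum_congr rfl fun t ht => ?_
  rw [Finset.prod_mul_distrib, Finset.prod_const, (Finset.mem_powersetCard.1 ht).2, map_prod]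

theorem coeff_normPoly_esymm {M : ℕ} (hM : 0 < M) {q : ℂ} (hq : IsPrimitiveRoot q M)
    (m : Fin (n + 1)) :
    (normPoly M q fun m : Fin (n + 1) => esymm (Fin n) ℂ m).coeff (M * m) =
      (-(-1 : ℂ) ^ M) ^ (m : ℕ) • expand M (esymm (Fin n) ℂ m) := by
  have hq' : IsPrimitiveRoot (Polynomial.C (C q : MvPolynomial (Fin n) ℂ)) M :=
    (hq.map_of_injective (C_injective (Fin n) ℂ)).map_of_injective Polynomial.C_injective
  have h1 : (normPoly M q fun m : Fin (n + 1) => esymm (Fin n) ℂ m) =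
      ∏ i : Fin n, (1 - (-(Polynomial.C (X i : MvPolynomial (Fin n) ℂ) * Polynomial.X)) ^ M) := by
    rw [normPoly, genPoly_esymm]
    simp only [Polynomial.prod_comp]
    rw [Finset.prod_comm]
    refine Finset.prod_congr rfl fun i _ => ?_
    rw [← one_pow M, ← prod_sub_pow_mul hM hq', one_pow]
    refine Finset.prod_congr rfl fun j _ => ?_
    simp only [Polynomial.add_comp, Polynomial.one_comp, Polynomial.mul_comp, Polynomial.C_comp,
      Polynomial.X_comp, algebraMap_eq, map_pow]
    ring
  have h2 : (normPoly M q fun m : Fin (n + 1) => esymm (Fin n) ℂ m) =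
      ∑ m : Fin (n + 1), Polynomial.C ((-(-1 : ℂ) ^ M) ^ (m : ℕ) • expand M (esymm (Fin n) ℂ m)) *
        Polynomial.X ^ (M * m) := by
    have h3 := congrArg (fun p => (Polynomial.map (expand M).toRingHom p).comp
      (Polynomial.C (C (-(-1 : ℂ) ^ M)) * Polynomial.X ^ M)) (genPoly_esymm (n := n))
    have h4 : ∏ i : Fin n, (1 - (-(Polynomial.C (X i : MvPolynomial (Fin n) ℂ) * Polynomial.X)) ^ M) =
        ((∏ i : Fin n, (1 + Polynomial.C (X i : MvPolynomial (Fin n) ℂ) * Polynomial.X)).map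
          (expand M).toRingHom).comp (Polynomial.C (C (-(-1 : ℂ) ^ M)) * Polynomial.X ^ M) := by
      rw [Polynomial.map_prod, Polynomial.prod_comp]
      refine Finset.prod_congr rfl fun i _ => ?_
      simp [neg_pow (Polynomial.C (X i : MvPolynomial (Fin n) ℂ) * Polynomial.X), mul_pow]
      ring
    rw [h1, h4, ← genPoly_esymm, genPoly, Polynomial.map_sum, Polynomial.sum_comp]
    refine Finset.sum_congr rfl fun m _ => ?_
    simp only [Polynomial.map_mul, Polynomial.map_pow, Polynomial.map_X, Polynomial.map_C,
      Polynomial.mul_comp, Polynomial.C_comp, Polynomial.pow_comp, Polynomial.X_comp, mul_pow,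
      ← pow_mul, smul_eq_C_mul]
    rw [← Polynomial.C_pow, ← C_pow, ← mul_assoc, ← Polynomial.C_mul, mul_comm (C _)]
    rfl
  rw [h2, Polynomial.finsetSum_coeff, Finset.sum_eq_single m]
  · simp
  · intro b _ hb
    rw [Polynomial.coeff_C_mul, Polynomial.coeff_X_pow, if_neg, mul_zero]
    intro h
    exact hb (Fin.ext (Nat.eq_of_mul_eq_mul_left hM h).symm)
  · simp

/-- The polynomial that expresses `esymm (i + 1)` of the `M`-th powers of the variables, up to a
sign, through the elementary symmetric polynomials. -/
noncomputable def powerRelation (n M : ℕ) (q : ℂ) (i : Fin n) : MvPolynomial (Fin n) ℂ :=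
  (normPoly M q fun m : Fin (n + 1) =>
    monomial ((Fin.cons 0 fun j => Finsupp.single j 1 : Fin (n + 1) → Fin n →₀ ℕ) m) (1 : ℂ)).coeff
      (M * (i.succ : Fin (n + 1)))

theorem hasLeadingTerm_powerRelation (n M : ℕ) (q : ℂ) (i : Fin n) :
    HasLeadingTerm (Finsupp.weight fun i : Fin n => (i : ℕ) + 1)
      (Finsupp.weight fun i : Fin n => ((i : ℕ) + 1) ^ 2) (powerRelation n M q i)
      (q ^ (∑ j : Fin M, (j : ℕ) * (i.succ : ℕ))) (Finsupp.single i M) := by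
  have := hasLeadingTerm_coeff_normPoly (δ := Finsupp.weight fun i : Fin n => (i : ℕ) + 1)
    (Q := Finsupp.weight fun i : Fin n => ((i : ℕ) + 1) ^ 2)
    (Fin.cons 0 fun j => Finsupp.single j 1 : Fin (n + 1) → Fin n →₀ ℕ) (A := 0) (B := 1)
    (fun m => by
      refine Fin.cases ?_ (fun j => ?_) m
      · simp
      · simp [Finsupp.weight_single])
    (fun m => by
      refine Fin.cases ?_ (fun j => ?_) m
      · simp
      · simp [Finsupp.weight_single]) M q i.succ
  rw [Fin.cons_succ, Finsupp.smul_single, smul_eq_mul, mul_one] at this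
  exact this

theorem aeval_powerRelation {M : ℕ} (hM : 0 < M) {q : ℂ} (hq : IsPrimitiveRoot q M) (i : Fin n) :
    aeval (fun i : Fin n => esymm (Fin n) ℂ (i + 1)) (powerRelation n M q i) =
      (-(-1 : ℂ) ^ M) ^ ((i : ℕ) + 1) • expand M (esymm (Fin n) ℂ (i + 1)) := by
  have h := coeff_normPoly_esymm hM hq i.succ
  rw [Fin.val_succ] at h
  rw [← h, powerRelation, normPoly_map, Fin.val_succ]
  congr 2
  funext m
  refine Fin.cases ?_ (fun j => ?_) m
  · simp
  · rw [Fin.cons_succ, ← X, aeval_X, Fin.val_succ]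

/-- The monomial `∏ e_{i+1} ^ (α i)` in the elementary symmetric polynomials. -/
noncomputable def esymmMonomial {M : ℕ} (α : Fin n → Fin M) : MvPolynomial (Fin n) ℂ :=
  ∏ i : Fin n, esymm (Fin n) ℂ ((i : ℕ) + 1) ^ (α i : ℕ)

/-- The combination of the monomials `∏ e_{i+1} ^ (α i)` with coefficients `h α` evaluated at the
`M`-th powers of the variables. -/
noncomputable def combine (n M : ℕ) :
    ((Fin n → Fin M) → MvPolynomial (Fin n) ℂ) →ₗ[ℂ] MvPolynomial (Fin n) ℂ where
  toFun h := ∑ α, esymmMonomial α * expand M (h α)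
  map_add' h h' := by simp [mul_add, Finset.sum_add_distrib]
  map_smul' c h := by simp [Finset.smul_sum]

theorem combine_apply (n M : ℕ) (h : (Fin n → Fin M) → MvPolynomial (Fin n) ℂ) :
    combine n M h = ∑ α, esymmMonomial α * expand M (h α) := rfl

theorem isSymmetric_esymmMonomial {M : ℕ} (α : Fin n → Fin M) :
    (esymmMonomial α).IsSymmetric := by
  have : esymmMonomial α ∈ symmetricSubalgebra (Fin n) ℂ :=
    prod_mem fun i _ => pow_mem (esymm_isSymmetric (Fin n) ℂ _) _
  exact this

theorem isSymmetric_expand {h : MvPolynomial (Fin n) ℂ} (hh : h.IsSymmetric) (M : ℕ) :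
    (expand M h).IsSymmetric := by
  intro σ
  rw [rename_expand, hh σ]

/-- The symmetric polynomials are spanned, over the symmetric polynomials in the `M`-th powers of
the variables, by the monomials in the elementary symmetric polynomials with exponents less than
`M`. -/
theorem exists_combine_eq {M : ℕ} (hM : 0 < M) {q : ℂ} (hq : IsPrimitiveRoot q M)
    {f : MvPolynomial (Fin n) ℂ} (hf : f.IsSymmetric) :
    ∃ h : (Fin n → Fin M) → MvPolynomial (Fin n) ℂ, (∀ α, (h α).IsSymmetric) ∧
      combine n M h = f := by
  classical
  obtain ⟨p, hp⟩ := esymmAlgHom_surjective (σ := Fin n) ℂ (n := n) (by simp) ⟨f, hf⟩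
  have hp' : aeval (fun i : Fin n => esymm (Fin n) ℂ (i + 1)) p = f := by
    rw [← esymmAlgHom_apply, hp]
  let N : Submodule ℂ (MvPolynomial (Fin n) ℂ) :=
    (Submodule.pi Set.univ fun _ : Fin n → Fin M =>
      Subalgebra.toSubmodule (symmetricSubalgebra (Fin n) ℂ)).map (combine n M)
  have hq0 : q ≠ 0 := hq.ne_zero hM.ne'
  have key : ∀ γ, aeval (fun i : Fin n => esymm (Fin n) ℂ (i + 1))
      (adapted M (powerRelation n M q) γ) ∈ N := by
    intro γ
    let α : Fin n → Fin M := fun i => ⟨γ i % M, Nat.mod_lt _ hM⟩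
    let g : MvPolynomial (Fin n) ℂ :=
      ∏ i : Fin n, ((-(-1 : ℂ) ^ M) ^ ((i : ℕ) + 1) • esymm (Fin n) ℂ (i + 1)) ^ (γ i / M)
    have hg : g ∈ symmetricSubalgebra (Fin n) ℂ :=
      prod_mem fun i _ => pow_mem (Subalgebra.smul_mem _ (esymm_isSymmetric (Fin n) ℂ _) _) _
    refine ⟨Pi.single α g, ?_, ?_⟩
    · intro β _
      by_cases hβ : β = α
      · subst hβ; simpa using hg
      · simp [hβ]
    · rw [combine_apply, Finset.sum_eq_single α]
      · rw [Pi.single_eq_same, adapted, map_prod, esymmMonomial, map_prod,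
          ← Finset.prod_mul_distrib]
        refine Finset.prod_congr rfl fun i _ => ?_
        rw [map_mul, map_pow, map_pow, map_pow, aeval_X, aeval_powerRelation hM hq, map_smul]
      · intro β _ hβ
        simp [hβ]
      · simp
  have hspan : p ∈ Submodule.span ℂ (Set.range (adapted M (powerRelation n M q))) := by
    have : (⊤ : Submodule ℂ (MvPolynomial (Fin n) ℂ)) ≤
        Submodule.span ℂ (Set.range (adapted M (powerRelation n M q))) := by
      rw [← (basisMonomials (Fin n) ℂ).span_eq, Submodule.span_le]
      rintro _ ⟨γ, rfl⟩
      rw [coe_basisMonomials]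
      refine Submodule.span_mono (Set.image_subset_range _ _)
        (monomial_mem_span_of_hasLeadingTerm
          (c := fun γ => ∏ i : Fin n, (q ^ (∑ j : Fin M, (j : ℕ) * (i.succ : ℕ))) ^ (γ i / M))
          (fun γ => Finset.prod_ne_zero_iff.2 fun _ _ => pow_ne_zero _ (pow_ne_zero _ hq0))
          (HasLeadingTerm.adapted (hasLeadingTerm_powerRelation n M q)) (B := fun D => n * D)
          (fun γ => ?_) γ)
      rw [Finsupp.weight_apply, Finsupp.weight_apply, Finsupp.sum_fintype _ _ (by simp),
        Finsupp.sum_fintype _ _ (by simp), Finset.mul_sum]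
      refine Finset.sum_le_sum fun i _ => ?_
      have : (i : ℕ) + 1 ≤ n := i.2
      simp only [smul_eq_mul]
      nlinarith [Nat.mul_le_mul_left (γ i * ((i : ℕ) + 1)) this]
    exact this trivial
  have hN : Submodule.span ℂ (Set.range (adapted M (powerRelation n M q))) ≤
      N.comap (aeval (fun i : Fin n => esymm (Fin n) ℂ (i + 1))).toLinearMap := by
    rw [Submodule.span_le]
    rintro _ ⟨γ, rfl⟩
    exact key γ
  obtain ⟨h, hh, hfh⟩ : aeval (fun i : Fin n => esymm (Fin n) ℂ (i + 1)) p ∈ N := hN hspan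
  exact ⟨h, fun α => hh α trivial, hfh.trans hp'⟩

end PowerExpansion

section Fibre

open MvPolynomial

variable {n M : ℕ}

/-- On a generic fibre of `x ↦ x ^ M`, the monomials `∏ e_{i+1} ^ (α i)` with exponents less than
`M` are linearly independent. -/
theorem eq_zero_of_sum_esymmMonomial_eq_zero (hM : 0 < M) {q : ℂ} (hq : IsPrimitiveRoot q M)
    {x : Fin n → ℂ} (hx0 : ∀ i, x i ≠ 0) (hx : Function.Injective (x ^ M))
    {c : (Fin n → Fin M) → ℂ}
    (hc : ∀ ζ : Fin n → Fin M,
      ∑ α, eval (fun i => q ^ (ζ i : ℕ) * x i) (esymmMonomial α) * c α = 0) : c = 0 := by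
  classical
  have hqM : ∀ (ζ : Fin n → Fin M), (fun i => q ^ (ζ i : ℕ) * x i) ^ M = x ^ M := by
    intro ζ
    funext i
    simp only [Pi.pow_apply]
    rw [mul_pow, ← pow_mul, mul_comm (ζ i : ℕ), pow_mul, hq.pow_eq_one, one_pow, one_mul]
  let L : ((Fin n → Fin M) → ℂ) →ₗ[ℂ] (Fin n → Fin M) → ℂ :=
    { toFun := fun c ζ => ∑ α, eval (fun i => q ^ (ζ i : ℕ) * x i) (esymmMonomial α) * c α
      map_add' := fun c c' => by
        funext ζ; simp [mul_add, Finset.sum_add_distrib]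
      map_smul' := fun a c => by
        funext ζ; simp [Finset.mul_sum, mul_left_comm] }
  have hsingle : ∀ ζ₀, Pi.single ζ₀ 1 ∈ LinearMap.range L := by
    intro ζ₀
    have hs : ∀ ζ : Fin n → Fin M, ∃ s : MvPolynomial (Fin n) ℂ, s.IsSymmetric ∧ (ζ ≠ ζ₀ →
        eval (fun i => q ^ (ζ i : ℕ) * x i) s = 0 ∧ eval (fun i => q ^ (ζ₀ i : ℕ) * x i) s ≠ 0) := by
      intro ζ
      by_cases hζ : ζ = ζ₀
      · exact ⟨0, IsSymmetric.zero, fun h => absurd hζ h⟩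
      obtain ⟨i, hi⟩ := Function.ne_iff.1 hζ
      refine ⟨∏ j, (C (q ^ (ζ i : ℕ) * x i) - X j), fun σ => ?_, fun _ => ⟨?_, ?_⟩⟩
      · rw [map_prod]
        simp only [map_sub, rename_C, rename_X]
        exact Equiv.prod_comp σ fun j => C (q ^ (ζ i : ℕ) * x i) - X j
      · rw [map_prod]
        exact Finset.prod_eq_zero (Finset.mem_univ i) (by simp)
      · rw [map_prod, Finset.prod_ne_zero_iff]
        intro j _ h0
        simp only [map_sub, eval_C, eval_X, sub_eq_zero] at h0
        have h1 := congrFun (hqM ζ) i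
        have h2 := congrFun (hqM ζ₀) j
        simp only [Pi.pow_apply] at h1 h2
        rw [h0, h2] at h1
        have hji : j = i := hx h1
        subst hji
        have h3 := mul_right_cancel₀ (hx0 j) h0
        exact hi (Fin.ext (hq.pow_inj (ζ j).2 (ζ₀ j).2 h3))
    choose s hs hs' using hs
    let g := ∏ ζ ∈ Finset.univ.erase ζ₀, s ζ
    have hg : g ∈ symmetricSubalgebra (Fin n) ℂ := prod_mem fun ζ _ => hs ζ
    obtain ⟨h, -, hh⟩ := exists_combine_eq hM hq (f := g) hg
    have hval : ∀ ζ, L (fun α => eval (x ^ M) (h α)) ζ =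
        eval (fun i => q ^ (ζ i : ℕ) * x i) g := by
      intro ζ
      rw [← hh, combine_apply, map_sum]
      simp only [map_mul, eval_expand, hqM]
      rfl
    have h0 : eval (fun i => q ^ (ζ₀ i : ℕ) * x i) g ≠ 0 := by
      rw [map_prod, Finset.prod_ne_zero_iff]
      exact fun ζ hζ => (hs' ζ (Finset.ne_of_mem_erase hζ)).2
    refine ⟨(eval (fun i => q ^ (ζ₀ i : ℕ) * x i) g)⁻¹ • fun α => eval (x ^ M) (h α), ?_⟩
    rw [map_smul]
    funext ζ
    rw [Pi.smul_apply, hval]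
    by_cases hζ : ζ = ζ₀
    · subst hζ; simp [h0]
    · rw [Pi.single_eq_of_ne hζ, map_prod (eval fun i => q ^ (ζ i : ℕ) * x i),
        Finset.prod_eq_zero (Finset.mem_erase.2 ⟨hζ, Finset.mem_univ ζ⟩) (hs' ζ hζ).1, smul_zero]
  have hsurj : Function.Surjective L := by
    intro φ
    have : φ = ∑ ζ, φ ζ • Pi.single ζ (1 : ℂ) := by
      funext ζ; simp [Finset.sum_apply, Pi.single_apply]
    rw [← LinearMap.mem_range, this]
    exact Submodule.sum_mem _ fun ζ _ => Submodule.smul_mem _ _ (hsingle ζ)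
  refine LinearMap.injective_iff_surjective.2 hsurj ?_
  rw [map_zero]
  funext ζ
  exact hc ζ

/-- A polynomial that vanishes at the points of the wheel with distinct nonzero coordinates
vanishes on the whole wheel. -/
theorem eval_eq_zero_of_generic {K : ℕ} (hK : 0 < K) {T : ℂ} (hT : IsPrimitiveRoot T K)
    (hn : K ≤ n) {h : MvPolynomial (Fin n) ℂ}
    (hh : ∀ (y : Fin n → ℂ) (c : ℂ), (∀ i : Fin K, y (Fin.castLE hn i) = c * T ^ (i : ℕ)) →
      (∀ i, y i ≠ 0) → Function.Injective y → eval y h = 0)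
    {y : Fin n → ℂ} {c : ℂ} (hy : ∀ i : Fin K, y (Fin.castLE hn i) = c * T ^ (i : ℕ)) :
    eval y h = 0 := by
  classical
  let o : Fin n := ⟨0, hK.trans_le hn⟩
  let w : Fin n → MvPolynomial (Fin n) ℂ := fun i =>
    if (i : ℕ) < K then C (T ^ (i : ℕ)) * X o else X i
  have hw : ∀ (x : Fin n → ℂ) i, eval x (w i) = if (i : ℕ) < K then T ^ (i : ℕ) * x o else x i := by
    intro x i
    simp only [w]
    split_ifs <;> simp
  have heval : ∀ x : Fin n → ℂ, eval x (bind₁ w h) = eval (fun i => eval x (w i)) h := by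
    intro x
    simp only [← coe_aeval_eq_eval, RingHom.coe_coe, aeval_bind₁]
  let D : MvPolynomial (Fin n) ℂ :=
    (∏ i, w i) * ∏ p ∈ Finset.univ.filter (fun p : Fin n × Fin n => p.1 ≠ p.2), (w p.1 - w p.2)
  have hD : D ≠ 0 := by
    intro hD
    let x : Fin n → ℂ := fun i => if i = o then 1 else ((i : ℕ) + 2 : ℕ)
    have hxo : x o = 1 := by simp [x]
    have hne : ∀ i : Fin n, ¬ (i : ℕ) < K → x i = ((i : ℕ) + 2 : ℕ) := fun i hi => by
      have : i ≠ o := by rintro rfl; exact hi hK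
      simp [x, this]
    have hnorm : ∀ i : Fin n, (i : ℕ) < K → ‖eval x (w i)‖ = 1 := fun i hi => by
      rw [hw, if_pos hi, hxo, mul_one, norm_pow, hT.norm'_eq_one hK.ne', one_pow]
    have hnorm' : ∀ i : Fin n, ¬ (i : ℕ) < K → ‖eval x (w i)‖ = ((i : ℕ) + 2 : ℕ) := fun i hi => by
      rw [hw, if_neg hi, hne i hi, Complex.norm_natCast]
    have h0 := congrArg (eval x) hD
    rw [map_zero, map_mul, mul_eq_zero, map_prod, map_prod, Finset.prod_eq_zero_iff,
      Finset.prod_eq_zero_iff] at h0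
    rcases h0 with ⟨i, -, hi⟩ | ⟨⟨i, j⟩, hij, h0⟩
    · rw [← norm_eq_zero] at hi
      by_cases hiK : (i : ℕ) < K
      · rw [hnorm i hiK] at hi; exact one_ne_zero hi
      · rw [hnorm' i hiK] at hi
        norm_cast at hi
    · have hij' : i ≠ j := (Finset.mem_filter.1 hij).2
      rw [map_sub, sub_eq_zero] at h0
      have h1 := congrArg norm h0
      by_cases hiK : (i : ℕ) < K <;> by_cases hjK : (j : ℕ) < K
      · rw [hw, hw, if_pos hiK, if_pos hjK, hxo, mul_one, mul_one] at h0
        exact hij' (Fin.ext (hT.pow_inj hiK hjK h0))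
      · rw [hnorm i hiK, hnorm' j hjK] at h1
        norm_cast at h1
        omega
      · rw [hnorm' i hiK, hnorm j hjK] at h1
        norm_cast at h1
        omega
      · rw [hnorm' i hiK, hnorm' j hjK] at h1
        norm_cast at h1
        exact hij' (Fin.ext (by omega))
  have hmul : bind₁ w h * D = 0 := by
    refine MvPolynomial.funext fun x => ?_
    rw [map_mul, heval, map_zero]
    by_cases h0 : ∀ i, eval x (w i) ≠ 0
    · by_cases hinj : Function.Injective fun i => eval x (w i)
      · rw [hh _ (x o) (fun i => ?_) h0 hinj, zero_mul]
        rw [hw, if_pos (by simp), mul_comm]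
        rfl
      · simp only [Function.Injective] at hinj
        push Not at hinj
        obtain ⟨i, j, hij, hne⟩ := hinj
        rw [map_mul (eval x) (∏ i, w i), map_prod (eval x) (fun p : Fin n × Fin n => w p.1 - w p.2),
          Finset.prod_eq_zero (i := (i, j)), mul_zero, mul_zero]
        · simp [hne]
        · simp [hij]
    · push Not at h0
      obtain ⟨i, hi⟩ := h0
      rw [map_mul (eval x) (∏ i, w i), map_prod (eval x) w,
        Finset.prod_eq_zero (Finset.mem_univ i) hi, zero_mul, mul_zero]
  have hzero : bind₁ w h = 0 := (mul_eq_zero.1 hmul).resolve_right hD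
  have hyw : (fun i => eval y (w i)) = y := by
    have ho : y o = c := by simpa using hy ⟨0, hK⟩
    funext i
    rw [hw]
    split_ifs with hi
    · have : y i = c * T ^ (i : ℕ) := hy ⟨i, hi⟩
      rw [this, ho, mul_comm]
    · rfl
  rw [← hyw, ← heval, hzero, map_zero]

theorem eq_zero_of_generic {h : MvPolynomial (Fin n) ℂ}
    (hh : ∀ y : Fin n → ℂ, (∀ i, y i ≠ 0) → Function.Injective y → eval y h = 0) : h = 0 := by
  refine MvPolynomial.funext fun y => ?_
  rw [map_zero]
  rcases n with _ | n
  · exact hh y (fun i => i.elim0) fun i => i.elim0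
  · refine eval_eq_zero_of_generic one_pos (T := 1) IsPrimitiveRoot.one (by omega)
      (fun y _ _ h0 hy => hh y h0 hy) (c := y 0) (fun i => ?_)
    have : i = 0 := Subsingleton.elim _ _
    subst this
    simp

theorem exists_root_of_generic (hM : 0 < M) {y : Fin n → ℂ} (h0 : ∀ i, y i ≠ 0) :
    ∃ x : Fin n → ℂ, (∀ i, x i ≠ 0) ∧ x ^ M = y := by
  choose x hx using fun i => IsAlgClosed.exists_pow_nat_eq (y i) hM
  refine ⟨x, fun i hi => h0 i ?_, funext hx⟩
  rw [← hx i, hi, zero_pow hM.ne']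

/-- The value of a combination at a point of the fibre over `x ^ M`. -/
theorem eval_combine {q : ℂ} (hq : IsPrimitiveRoot q M) (h : (Fin n → Fin M) →
    MvPolynomial (Fin n) ℂ) (x : Fin n → ℂ) (ζ : Fin n → Fin M) :
    eval (fun i => q ^ (ζ i : ℕ) * x i) (combine n M h) =
      ∑ α, eval (fun i => q ^ (ζ i : ℕ) * x i) (esymmMonomial α) * eval (x ^ M) (h α) := by
  rw [combine_apply, map_sum]
  refine Finset.sum_congr rfl fun α _ => ?_
  rw [map_mul, eval_expand]
  congr 3
  funext i
  simp only [Pi.pow_apply]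
  rw [mul_pow, ← pow_mul, mul_comm (ζ i : ℕ), pow_mul, hq.pow_eq_one, one_pow, one_mul]

theorem combine_injective (hM : 0 < M) {q : ℂ} (hq : IsPrimitiveRoot q M) :
    Function.Injective (combine n M) := by
  rw [← LinearMap.ker_eq_bot, LinearMap.ker_eq_bot']
  intro h hh
  funext α
  refine eq_zero_of_generic fun y h0 hy => ?_
  obtain ⟨x, hx0, rfl⟩ := exists_root_of_generic hM h0
  exact congrFun (eq_zero_of_sum_esymmMonomial_eq_zero hM hq hx0 hy
    (c := fun α => eval (x ^ M) (h α)) fun ζ => by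
      rw [← eval_combine hq, hh, map_zero]) α

/-- A combination satisfies the wheel condition relative to `{t, t q, …, t q ^ (M - 1)}` if and only
if its coefficients satisfy the wheel condition relative to `{t ^ M}`. -/
theorem satisfies_combine_iff {K : ℕ} (hK : 0 < K) (hM : 0 < M) (hKM : Nat.Coprime K M) {t q : ℂ}
    (ht : IsPrimitiveRoot t K) (hq : IsPrimitiveRoot q M)
    (h : (Fin n → Fin M) → MvPolynomial (Fin n) ℂ) :
    Satisfies (wheelSet M q t) (combine n M h) ↔
      ∀ α, Satisfies (wheelSet 1 1 (t ^ M)) (h α) := by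
  have hT : IsPrimitiveRoot (t ^ M) K := ht.pow_of_coprime M hKM.symm
  rw [satisfies_wheelSet_iff hK hM hKM ht hq]
  simp only [satisfies_wheelSet_iff hK one_pos (Nat.coprime_one_right K) hT IsPrimitiveRoot.one,
    pow_one]
  constructor
  · intro hf α hn y c hy
    refine eval_eq_zero_of_generic hK hT hn (fun y c hy h0 hinj => ?_) hy
    obtain ⟨x, hx0, rfl⟩ := exists_root_of_generic hM h0
    refine congrFun (eq_zero_of_sum_esymmMonomial_eq_zero hM hq hx0 hinj
      (c := fun α => eval (x ^ M) (h α)) fun ζ => ?_) α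
    rw [← eval_combine hq]
    refine hf hn _ c fun i => ?_
    rw [← hy i, mul_pow, ← pow_mul, mul_comm (ζ _ : ℕ), pow_mul, hq.pow_eq_one, one_pow, one_mul]
    rfl
  · intro hα hn x c hx
    rw [combine_apply, map_sum]
    refine Finset.sum_eq_zero fun α _ => ?_
    rw [map_mul, eval_expand, hα α hn (x ^ M) c hx, mul_zero]

end Fibre

section Graded

open MvPolynomial

variable {n M : ℕ}

/-- The degree of the monomial `∏ e_{i+1} ^ (α i)`. -/
def esymmDegree (α : Fin n → Fin M) : ℕ := ∑ i : Fin n, ((i : ℕ) + 1) * (α i : ℕ)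

theorem isHomogeneous_esymm (m : ℕ) : (esymm (Fin n) ℂ m).IsHomogeneous m := by
  rw [esymm]
  refine IsHomogeneous.sum _ _ _ fun t ht => ?_
  have := IsHomogeneous.prod t (fun i => (X i : MvPolynomial (Fin n) ℂ)) (fun _ => 1)
    fun i _ => isHomogeneous_X ℂ i
  simpa [(Finset.mem_powersetCard.1 ht).2] using this

theorem isHomogeneous_esymmMonomial (α : Fin n → Fin M) :
    (esymmMonomial α).IsHomogeneous (esymmDegree α) :=
  IsHomogeneous.prod _ _ _ fun i _ => (isHomogeneous_esymm ((i : ℕ) + 1)).pow _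

theorem isHomogeneous_esymmMonomial_mul_expand (α : Fin n → Fin M) {h : MvPolynomial (Fin n) ℂ}
    {e : ℕ} (hh : h.IsHomogeneous e) :
    (esymmMonomial α * expand M h).IsHomogeneous (esymmDegree α + M * e) := by
  refine (isHomogeneous_esymmMonomial α).mul ?_
  have := hh.aeval (n := M) (fun i => (X i : MvPolynomial (Fin n) ℂ) ^ M) fun i => by
    simpa using (isHomogeneous_X ℂ i).pow M
  exact this

/-- The condition that `esymmDegree α + M e = d` for some `e`. -/
def HasCodegree (α : Fin n → Fin M) (d : ℕ) : Prop := esymmDegree α ≤ d ∧ M ∣ d - esymmDegree α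

instance (α : Fin n → Fin M) (d : ℕ) : Decidable (HasCodegree α d) :=
  inferInstanceAs (Decidable (_ ∧ _))

theorem HasCodegree.eq {α : Fin n → Fin M} {d : ℕ} (h : HasCodegree α d) :
    esymmDegree α + M * ((d - esymmDegree α) / M) = d := by
  rw [Nat.mul_div_cancel' h.2]
  exact Nat.add_sub_of_le h.1

theorem hasCodegree_of_eq {α : Fin n → Fin M} {d e : ℕ} (h : esymmDegree α + M * e = d) :
    HasCodegree α d :=
  ⟨by omega, ⟨e, by omega⟩⟩

theorem homogeneousComponent_esymmMonomial_mul_expand (hM : 0 < M) (α : Fin n → Fin M)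
    (h : MvPolynomial (Fin n) ℂ) (d : ℕ) :
    homogeneousComponent d (esymmMonomial α * expand M h) = if HasCodegree α d then
      esymmMonomial α * expand M (homogeneousComponent ((d - esymmDegree α) / M) h) else 0 := by
  have h1 : homogeneousComponent d (esymmMonomial α * expand M h) =
      ∑ i ∈ Finset.range (h.totalDegree + 1), if esymmDegree α + M * i = d then
        esymmMonomial α * expand M (homogeneousComponent i h) else 0 := by
    conv_lhs => rw [← sum_homogeneousComponent h]
    rw [map_sum, Finset.mul_sum, map_sum]
    refine Finset.sum_congr rfl fun i _ => ?_
    rw [homogeneousComponent_of_mem (isHomogeneous_esymmMonomial_mul_expand α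
      (homogeneousComponent_isHomogeneous i h))]
    simp only [eq_comm]
  rw [h1]
  split_ifs with hd
  · rw [Finset.sum_eq_single ((d - esymmDegree α) / M)]
    · rw [if_pos hd.eq]
    · intro i _ hi
      refine if_neg fun hi' => hi ?_
      have := hd.eq
      exact Nat.eq_of_mul_eq_mul_left hM (by omega)
    · intro hi
      rw [if_pos hd.eq, homogeneousComponent_eq_zero _ _ (by simpa using hi), map_zero, mul_zero]
  · exact Finset.sum_eq_zero fun i _ => if_neg fun hi => hd (hasCodegree_of_eq hi)

/-- The possible coefficients of `∏ e_{i+1} ^ (α i)` in a polynomial of degree `d`. -/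
noncomputable def coefficientSpace (S : Set ℂ) (d : ℕ) (α : Fin n → Fin M) :
    Submodule ℂ (MvPolynomial (Fin n) ℂ) :=
  if HasCodegree α d then gradedPiece S n ((d - esymmDegree α) / M) else ⊥

instance (S : Set ℂ) (d : ℕ) (α : Fin n → Fin M) :
    FiniteDimensional ℂ (coefficientSpace S d α) := by
  by_cases h : HasCodegree α d
  · rw [coefficientSpace, if_pos h]
    infer_instance
  · rw [coefficientSpace, if_neg h]
    infer_instance

theorem coefficientSpace_le (S : Set ℂ) (d : ℕ) (α : Fin n → Fin M) :
    coefficientSpace S d α ≤ symSpace S n := by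
  unfold coefficientSpace
  split_ifs
  · exact inf_le_left
  · exact bot_le

theorem finrank_coefficientSpace (S : Set ℂ) (d : ℕ) (α : Fin n → Fin M) :
    Module.finrank ℂ (coefficientSpace S d α) = if HasCodegree α d then
      Module.finrank ℂ (gradedPiece S n ((d - esymmDegree α) / M)) else 0 := by
  by_cases h : HasCodegree α d
  · rw [coefficientSpace, if_pos h, if_pos h]
  · rw [coefficientSpace, if_neg h, if_neg h, finrank_bot]

theorem finrank_gradedPiece_eq_sum {K : ℕ} (hK : 0 < K) (hM : 0 < M) (hKM : Nat.Coprime K M)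
    {t q : ℂ} (ht : IsPrimitiveRoot t K) (hq : IsPrimitiveRoot q M) (n d : ℕ) :
    Module.finrank ℂ (gradedPiece (wheelSet M q t) n d) =
      ∑ α : Fin n → Fin M, if HasCodegree α d then
        Module.finrank ℂ (gradedPiece (wheelSet 1 1 (t ^ M)) n ((d - esymmDegree α) / M))
          else 0 := by
  let Φ : (∀ α : Fin n → Fin M, coefficientSpace (wheelSet 1 1 (t ^ M)) d α) →ₗ[ℂ]
      MvPolynomial (Fin n) ℂ :=
    combine n M ∘ₗ LinearMap.pi fun α => (Submodule.subtype _) ∘ₗ LinearMap.proj α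
  have hΦ : ∀ h, Φ h = combine n M fun α => (h α).1 := fun _ => rfl
  have hinj : Function.Injective Φ := by
    intro h h' hh
    funext α
    exact Subtype.ext (congrFun (combine_injective hM hq hh) α)
  have hrange : LinearMap.range Φ = gradedPiece (wheelSet M q t) n d := by
    ext f
    constructor
    · rintro ⟨h, rfl⟩
      have hs := fun α => coefficientSpace_le _ _ _ (h α).2
      refine ⟨⟨?_, ?_⟩, ?_⟩
      · rw [hΦ]
        exact sum_mem (S := symmetricSubalgebra (Fin n) ℂ) fun α _ =>
          mul_mem (isSymmetric_esymmMonomial α) (isSymmetric_expand (hs α).1 M)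
      · rw [hΦ, satisfies_combine_iff hK hM hKM ht hq]
        exact fun α => (hs α).2
      · rw [hΦ, combine_apply]
        refine sum_mem fun α _ => ?_
        have hα := (h α).2
        unfold coefficientSpace at hα
        split_ifs at hα with hd
        · have := isHomogeneous_esymmMonomial_mul_expand α hα.2
          rw [hd.eq] at this
          exact this
        · rw [(Submodule.mem_bot ℂ).1 hα, map_zero, mul_zero]
          exact zero_mem _
    · rintro ⟨⟨hsym, hs⟩, hd⟩
      obtain ⟨h, hh, rfl⟩ := exists_combine_eq hM hq hsym
      let h' : (Fin n → Fin M) → MvPolynomial (Fin n) ℂ := fun α =>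
        if HasCodegree α d then homogeneousComponent ((d - esymmDegree α) / M) (h α) else 0
      have he : combine n M h' = combine n M h := by
        rw [← homogeneousComponent_eq_self hd, combine_apply, combine_apply, map_sum]
        refine Finset.sum_congr rfl fun α _ => ?_
        rw [homogeneousComponent_esymmMonomial_mul_expand hM]
        simp only [h']
        split_ifs <;> simp
      rw [← he, satisfies_combine_iff hK hM hKM ht hq] at hs
      refine ⟨fun α => ⟨h' α, ?_⟩, he⟩
      have hsα := hs α
      unfold coefficientSpace
      simp only [h'] at hsα ⊢
      split_ifs at hsα ⊢ with hc
      · refine ⟨⟨fun σ => ?_, hsα⟩, homogeneousComponent_isHomogeneous _ _⟩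
        rw [rename_homogeneousComponent, hh α σ]
      · exact zero_mem _
  rw [← hrange, LinearMap.finrank_range_of_inj hinj, Module.finrank_pi_fintype]
  exact Finset.sum_congr rfl fun α _ => finrank_coefficientSpace _ _ _

end Graded

section Character

open PowerSeries

theorem prod_eq_sum_esymmDegree (n : ℕ) {M : ℕ} :
    ∏ s ∈ Finset.Icc 1 n, ((1 - X ^ (s * M)) * (1 - X ^ s : PowerSeries ℚ)⁻¹) =
      ∑ α : Fin n → Fin M, X ^ esymmDegree α := by
  have h1 : ∀ i : Fin n, (1 - X ^ (((i : ℕ) + 1) * M)) * (1 - X ^ ((i : ℕ) + 1) : PowerSeries ℚ)⁻¹ =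
      ∑ j : Fin M, X ^ (((i : ℕ) + 1) * (j : ℕ)) := by
    intro i
    rw [Fin.sum_univ_eq_sum_range (fun j => (X : PowerSeries ℚ) ^ (((i : ℕ) + 1) * j)) M]
    have h2 := mul_neg_geom_sum ((X : PowerSeries ℚ) ^ ((i : ℕ) + 1)) M
    simp only [← pow_mul] at h2
    rw [← h2, mul_right_comm, PowerSeries.mul_inv_cancel _ (by simp), one_mul]
  have h3 : ∀ g : ℕ → PowerSeries ℚ, ∏ s ∈ Finset.Icc 1 n, g s = ∏ i : Fin n, g ((i : ℕ) + 1) := by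
    intro g
    rw [Fin.prod_univ_eq_prod_range (fun i => g (i + 1)) n, Finset.range_eq_Ico,
      Finset.prod_Ico_add' g 0 n 1]
    rfl
  rw [h3, Finset.prod_congr rfl fun i _ => h1 i, Finset.prod_univ_sum, Fintype.piFinset_univ]
  exact Finset.sum_congr rfl fun α _ => Finset.prod_pow_eq_pow_sum _ _ _

theorem finrank_gradedPiece_singleton (k : ℕ) {T : ℂ} (hT : IsPrimitiveRoot T (k + 1)) (n d : ℕ) :
    (Module.finrank ℂ (gradedPiece (wheelSet 1 1 T) n d) : ℚ) = coeff d (bCoeff k n) := by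
  rw [finrank_gradedPiece (Nat.succ_pos k) hT, card_boundedExponents_eq_coeff_bCoeff]

end Character

end WheelCondition

open PowerSeries WheelCondition in
theorem theorem4 (k r : ℕ) (hk : 0 < k) (hr : 2 ≤ r) (hkr : Nat.Coprime (k + 1) (r - 1))
    (t q : ℂ) (ht : IsPrimitiveRoot t (k + 1)) (hq : IsPrimitiveRoot q (r - 1)) :
    (∀ n : ℕ, coeff n (character (wheelSet 1 1 t)) = bCoeff k n) ∧
      character (wheelSet (r - 1) q t) =
        PowerSeries.mk fun n : ℕ =>
          PowerSeries.expand (r - 1) (by omega) (bCoeff k n) *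
            ∏ s ∈ Finset.Icc 1 n, ((1 - X ^ (s * (r - 1))) * (1 - X ^ s : PowerSeries ℚ)⁻¹) := by
  have hM : 0 < r - 1 := by omega
  refine ⟨fun n => ?_, ?_⟩
  · ext d
    simp only [character, coeff_mk]
    exact finrank_gradedPiece_singleton k ht n d
  · ext n d
    simp only [character, coeff_mk]
    rw [finrank_gradedPiece_eq_sum (Nat.succ_pos k) hM hkr ht hq, prod_eq_sum_esymmDegree,
      Finset.mul_sum, map_sum, Nat.cast_sum]
    refine Finset.sum_congr rfl fun α _ => ?_
    rw [coeff_mul_X_pow', coeff_expand]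
    have hT := ht.pow_of_coprime (r - 1) hkr.symm
    by_cases h1 : esymmDegree α ≤ d
    · by_cases h2 : r - 1 ∣ d - esymmDegree α
      · rw [if_pos ⟨h1, h2⟩, if_pos h1, if_pos h2, finrank_gradedPiece_singleton k hT]
      · rw [if_neg fun h => h2 h.2, if_pos h1, if_neg h2, Nat.cast_zero]
    · rw [if_neg fun h => h1 h.1, if_neg h1, Nat.cast_zero]
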